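/- **Setting.** Let $\mathbf{k}$ be a field, $Z$ a well-ordered set, $\mathcal S(Z)$ the free semigroup on $Z$, and $\mathfrak S(Z)$ the free operated semigroup on $Z$, i.e. the set of nonempty words whose letters are elements of $Z$ or bracketed words $\lfloor u\rfloor$ with $u\in\mathfrak S(Z)$. Then $\mathbf{k}\mathfrak S(Z)$, with the linear operator extending $u\mapsto\lfloor u\rfloor$, is the free nonunital operated algebra on $Z$; an operated ideal is a two-sided ideal closed under the operator, and $\langle T\rangle$ denotes the operated ideal generated by $T$. Let $\mathfrak S^\star(Z)$ be the set of words in $\mathfrak S(Z\sqcup\{\star\})$ with exactly one occurrence of $\star$, and let $q|_s$ be the result of replacing $\star$ by $s$ (extended linearly in $s$). **Orders.** $\le_{\mathrm{dlex}}$ is the degree-lexicographic order on words in $Z$. The order $\le_{\mathrm{db}}$ on $\mathfrak S(Z)$ compares $u=u_0\lfloor u_1^*\rfloor u_1\cdots\lfloor u_r^*\rfloor u_r$ ($u_i$ possibly empty words in $Z$, $u_i^*\in\mathfrak S(Z)$) first by the total number of brackets occurring in $u$, then by $r$, and then lexicographically by $(u_1^*,\dots,u_r^*,u_0,\dots,u_r)$,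 where the $u_i^*$ are compared recursively by $\le_{\mathrm{db}}$ and the $u_i$ by $\le_{\mathrm{dlex}}$. Both are monomial orders. **GS bases.** Let $\bar f$ be the leading monomial of $f\neq0$, and let the breadth $|u|$ be the number of letters of $u$, a bracketed word counting as one letter. A set $T\subseteq\mathbf{k}\mathfrak S(Z)$ is an operated Gröbner–Shirshov (GS) basis of the operated ideal $J$ if $\langle T\rangle=J$ and, for all nonzero $f,g\in T$ made monic: every $fu-vg$ with $w=\bar fu=v\bar g$ ($u,v\in\mathfrak S(Z)$) and $\max(|\bar f|,|\bar g|)<|w|<|\bar f|+|\bar g|$, and every $f-q|_g$ with $w=\bar f=q|_{\bar g}$ ($q\in\mathfrak S^\star(Z)$), is a linear combination of elements $q'|_s$ with $q'\in\mathfrak S^\star(Z)$, $0\ne s\in T$ and $q'|_{\bar s}<w$. GS bases of ideals of the free algebra $\mathbf{k}\mathcal S(Z)$ are defined in the same way, with $\mathcal S(Z)$ in place of $\mathfrak S(Z)$, with the words $a\star b$ ($a,b$ possibly empty words in $Z$) in place of $\mathfrak S^\star(Z)$, and with two-sided ideals. **Theorem.** Let $A=\mathbf{k}\mathcal S(Z)/I_A$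 be a (nonunital) algebra and let $G$ be a finite GS basis of $I_A$ with respect to $\le_{\mathrm{dlex}}$. Let $\lambda\in\mathbf{k}$, $\phi_4=\lfloor xy\rfloor-\lambda xy$ and $S_{\phi_4}(\mathfrak S(Z))=\{\lfloor uv\rfloor-\lambda uv : u,v\in\mathfrak S(Z)\}$. Let $\pi:\mathbf{k}\mathcal S(Z)\to\mathbf{k}Z$ be the projection onto the linear part and $\mathbf{k}\pi(G)$ the span of $\pi(G)$. Then $\mathbf{k}\pi(G)$ has a unique linearly self-reduced basis $G^{(1)}$, i.e. a basis each of whose elements has leading coefficient $1$ and such that no $z\in Z$ occurring in an element $s\in G^{(1)}$ is the leading element of an element of $G^{(1)}\setminus\{s\}$. With $$\mathcal G'=\{\lfloor g\rfloor-\lambda g : g\in G^{(1)}\},$$ the set $S_{\phi_4}(\mathfrak S(Z))\cup G\cup\mathcal G'$ is an operated GS basis of $\langle S_{\phi_4}(\mathfrak S(Z))\cup I_A\rangle$ in $\mathbf{k}\mathfrak S(Z)$ with respect to $\le_{\mathrm{db}}$. -/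

import Mathlib

universe u v

noncomputable section

namespace OperatedGS

/-! ### The free operated semigroup -/

/-- The free operated semigroup on a set `Z`: nonempty words whose letters are either elements of
`Z` or bracketed words. Every element is uniquely one of `z`, `⌊w⌋`, `z · w`, `⌊w'⌋ · w`. -/
inductive OpWord (Z : Type u) : Type u
  | var (z : Z) : OpWord Z
  | br (w : OpWord Z) : OpWord Z
  | varMul (z : Z) (w : OpWord Z) : OpWord Z
  | brMul (w' w : OpWord Z) : OpWord Z

namespace OpWord

/-- Concatenation of bracketed words. -/
def mul {Z : Type u} : OpWord Z → OpWord Z → OpWord Z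
  | var z, v => varMul z v
  | br w, v => brMul w v
  | varMul z w, v => varMul z (mul w v)
  | brMul w' w, v => brMul w' (mul w v)

theorem mul_assoc' {Z : Type u} (a b c : OpWord Z) : mul (mul a b) c = mul a (mul b c) := by
  induction a with
  | var z => rfl
  | br w _ => rfl
  | varMul z w ih => simp [mul, ih]
  | brMul w' w _ ih => simp [mul, ih]

instance {Z : Type u} : Semigroup (OpWord Z) where
  mul := mul
  mul_assoc := mul_assoc'

/-- Substitution of words for the variables: the homomorphism of operated semigroups
that extends `σ`. -/
def subst {X : Type u} {Z : Type v} (σ : X → OpWord Z) : OpWord X → OpWord Z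
  | var x => σ x
  | br w => br (subst σ w)
  | varMul x w => σ x * subst σ w
  | brMul w' w => br (subst σ w') * subst σ w

/-- The breadth `|u|`: the number of letters (elements of `Z` or bracketed words) of `u`. -/
def breadth {Z : Type u} : OpWord Z → ℕ
  | var _ => 1
  | br _ => 1
  | varMul _ w => breadth w + 1
  | brMul _ w => breadth w + 1

/-- The `P`-degree: the number of brackets occurring in a word, at all depths. -/
def degP {Z : Type u} : OpWord Z → ℕ
  | var _ => 0
  | br w => degP w + 1
  | varMul _ w => degP w
  | brMul w' w => degP w' + 1 + degP w

/-- For `u = u₀⌊u₁*⌋u₁⋯⌊uᵣ*⌋uᵣ` with `uᵢ` words in `Z`, the list `[u₁*, …, uᵣ*]`. Its length is the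
`P`-breadth `r` of `u`. -/
def brackets {Z : Type u} : OpWord Z → List (OpWord Z)
  | var _ => []
  | br w => [w]
  | varMul _ w => brackets w
  | brMul w' w => w' :: brackets w

/-- For `u = u₀⌊u₁*⌋u₁⋯⌊uᵣ*⌋uᵣ` with `uᵢ` (possibly empty) words in `Z`, the list
`[u₀, u₁, …, uᵣ]`. -/
def blocks {Z : Type u} : OpWord Z → List (List Z)
  | var z => [[z]]
  | br _ => [[], []]
  | varMul z w => (blocks w).modifyHead (z :: ·)
  | brMul _ w => [] :: blocks w

/-- The strict order `<_db`. Words are compared by `P`-degree, then by `P`-breadth, then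
lexicographically by `(u₁*, …, uᵣ*, u₀, …, uᵣ)`, where the `uᵢ*` are compared recursively by `<_db`
and the `uᵢ` by the degree-lexicographic order. -/
inductive DbLT {Z : Type u} [LinearOrder Z] : OpWord Z → OpWord Z → Prop
  | of_degP {x y : OpWord Z} (h : degP x < degP y) : DbLT x y
  | of_breadthP {x y : OpWord Z} (h : degP x = degP y)
      (h' : (brackets x).length < (brackets y).length) : DbLT x y
  | of_brackets {x y : OpWord Z} (h : degP x = degP y)
      (h' : (brackets x).length = (brackets y).length)
      (p s t : List (OpWord Z)) (a b : OpWord Z)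
      (hx : brackets x = p ++ a :: s) (hy : brackets y = p ++ b :: t)
      (hab : DbLT a b) : DbLT x y
  | of_blocks {x y : OpWord Z} (h : degP x = degP y) (h' : brackets x = brackets y)
      (p s t : List (List Z)) (a b : List Z)
      (hx : blocks x = p ++ a :: s) (hy : blocks y = p ++ b :: t)
      (hab : List.Shortlex (· < ·) a b) : DbLT x y

end OpWord

/-- Words in the free operated semigroup on `Z ∪ {⋆}` in which `⋆` occurs exactly once. Every such
word is uniquely one of `⋆`, `⋆ · w`, `⌊q⌋`, `⌊q⌋ · w`, `z · q`, `⌊w⌋ · q`. -/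
inductive StarWord (Z : Type u) : Type u
  | star : StarWord Z
  | starMul (w : OpWord Z) : StarWord Z
  | br (q : StarWord Z) : StarWord Z
  | brMul (q : StarWord Z) (w : OpWord Z) : StarWord Z
  | varMulStar (z : Z) (q : StarWord Z) : StarWord Z
  | brMulStar (w : OpWord Z) (q : StarWord Z) : StarWord Z

/-- `q|_u`: the word obtained from `q` by replacing `⋆` by `u`. -/
def StarWord.plug {Z : Type u} : StarWord Z → OpWord Z → OpWord Z
  | .star, u => u
  | .starMul w, u => u * w
  | .br q, u => .br (q.plug u)
  | .brMul q w, u => .brMul (q.plug u) w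
  | .varMulStar z q, u => .varMul z (q.plug u)
  | .brMulStar w q, u => .brMul w (q.plug u)

namespace OpWord

theorem varMul_eq {Z : Type u} (z : Z) (w : OpWord Z) : varMul z w = var z * w := rfl

theorem brMul_eq {Z : Type u} (w' w : OpWord Z) : brMul w' w = br w' * w := rfl

theorem degP_mul {Z : Type u} (a b : OpWord Z) : degP (a * b) = degP a + degP b := by
  change degP (mul a b) = _
  induction a with
  | var z => simp [mul, degP]
  | br w _ => simp [mul, degP]
  | varMul z w ih => simp [mul, degP, ih]
  | brMul w' w _ ih => simp [mul, degP, ih]; ring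

theorem brackets_mul {Z : Type u} (a b : OpWord Z) :
    brackets (a * b) = brackets a ++ brackets b := by
  change brackets (mul a b) = _
  induction a with
  | var z => simp [mul, brackets]
  | br w _ => simp [mul, brackets]
  | varMul z w ih => simp [mul, brackets, ih]
  | brMul w' w _ ih => simp [mul, brackets, ih]

theorem length_blocks {Z : Type u} (a : OpWord Z) :
    (blocks a).length = (brackets a).length + 1 := by
  induction a with
  | var z => simp [blocks, brackets]
  | br w _ => simp [blocks, brackets]
  | varMul z w ih => simp [blocks, brackets, ih]
  | brMul w' w _ ih => simp [blocks, brackets, ih]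

theorem blocks_ne_nil {Z : Type u} (a : OpWord Z) : blocks a ≠ [] := by
  intro h
  have := length_blocks a
  simp [h] at this

theorem blocks_mul {Z : Type u} (a b : OpWord Z) :
    ∃ (i j : List (List Z)) (l r : List Z),
      blocks a = i ++ [l] ∧ blocks b = r :: j ∧ blocks (a * b) = i ++ (l ++ r) :: j := by
  change ∃ (i j : List (List Z)) (l r : List Z),
      blocks a = i ++ [l] ∧ blocks b = r :: j ∧ blocks (mul a b) = i ++ (l ++ r) :: j
  induction a with
  | var z =>
    obtain ⟨r, j, h⟩ := List.exists_cons_of_ne_nil (blocks_ne_nil b)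
    exact ⟨[], j, [z], r, by simp [blocks, mul, h]⟩
  | br w _ =>
    obtain ⟨r, j, h⟩ := List.exists_cons_of_ne_nil (blocks_ne_nil b)
    exact ⟨[[]], j, [], r, by simp [blocks, mul, h]⟩
  | varMul z w ih =>
    obtain ⟨i, j, l, r, h1, h2, h3⟩ := ih
    cases i with
    | nil => exact ⟨[], j, z :: l, r, by simp [blocks, mul, h1, h2, h3]⟩
    | cons x i => exact ⟨(z :: x) :: i, j, l, r, by simp [blocks, mul, h1, h2, h3]⟩
  | brMul w' w _ ih =>
    obtain ⟨i, j, l, r, h1, h2, h3⟩ := ih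
    exact ⟨[] :: i, j, l, r, by simp [blocks, mul, h1, h2, h3]⟩

theorem degP_lt_of_mem_brackets {Z : Type u} (a : OpWord Z) :
    ∀ w ∈ brackets a, degP w < degP a := by
  induction a with
  | var z => simp [brackets]
  | br w _ => simp [brackets, degP]
  | varMul z w ih => simpa [brackets, degP] using ih
  | brMul w' w _ ih =>
    intro x hx
    simp only [brackets, List.mem_cons] at hx
    simp only [degP]
    rcases hx with rfl | hx
    · omega
    · have := ih x hx
      omega

theorem degP_pos_or {Z : Type u} (a : OpWord Z) : blocks a ≠ [[]] := by
  induction a with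
  | var z => simp [blocks]
  | br w _ => simp [blocks]
  | varMul z w ih =>
    obtain ⟨r, j, h⟩ := List.exists_cons_of_ne_nil (blocks_ne_nil w)
    simp [blocks, h]
  | brMul w' w _ ih =>
    simp [blocks, blocks_ne_nil w]

/-- A word is determined by its bracketed factors and by the blocks between them. -/
theorem eq_of_brackets_of_blocks {Z : Type u} (a : OpWord Z) :
    ∀ b : OpWord Z, brackets a = brackets b → blocks a = blocks b → a = b := by
  induction a with
  | var z =>
    intro b h1 h2
    cases b with
    | var z' => simpa [blocks] using h2
    | br w => simp [blocks] at h2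
    | varMul z' w =>
      obtain ⟨r, j, h⟩ := List.exists_cons_of_ne_nil (blocks_ne_nil w)
      simp only [blocks, h, List.modifyHead_cons, List.cons.injEq] at h2
      obtain ⟨⟨rfl, hr⟩, hj⟩ := h2
      exact absurd (by rw [h, ← hr, ← hj]) (degP_pos_or w)
    | brMul w' w => simp [blocks] at h2
  | br w _ =>
    intro b h1 h2
    cases b with
    | var z' => simp [blocks] at h2
    | br w => simpa [brackets] using h1
    | varMul z' w =>
      obtain ⟨r, j, h⟩ := List.exists_cons_of_ne_nil (blocks_ne_nil w)
      simp [blocks, h] at h2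
    | brMul w' w =>
      simp only [blocks, List.cons.injEq, true_and] at h2
      exact absurd h2.symm (degP_pos_or w)
  | varMul z w ih =>
    obtain ⟨r, j, h⟩ := List.exists_cons_of_ne_nil (blocks_ne_nil w)
    intro b h1 h2
    cases b with
    | var z' =>
      simp only [blocks, h, List.modifyHead_cons, List.cons.injEq] at h2
      obtain ⟨⟨rfl, hr⟩, hj⟩ := h2
      exact absurd (by rw [h, hr, hj]) (degP_pos_or w)
    | br w => simp [blocks, h] at h2
    | varMul z' w₂ =>
      obtain ⟨r', j', h'⟩ := List.exists_cons_of_ne_nil (blocks_ne_nil w₂)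
      simp only [blocks, h, h', List.modifyHead_cons, List.cons.injEq] at h2
      obtain ⟨⟨rfl, rfl⟩, rfl⟩ := h2
      rw [ih w₂ (by simpa [brackets] using h1) (by rw [h, h'])]
    | brMul w' w => simp [blocks, h] at h2
  | brMul w' w _ ih =>
    intro b h1 h2
    cases b with
    | var z' => simp [blocks] at h2
    | br w₂ =>
      simp only [blocks, List.cons.injEq, true_and] at h2
      exact absurd h2 (degP_pos_or w)
    | varMul z' w₂ =>
      obtain ⟨r', j', h'⟩ := List.exists_cons_of_ne_nil (blocks_ne_nil w₂)
      simp [blocks, h'] at h2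
    | brMul w₁ w₂ =>
      simp only [blocks, brackets, List.cons.injEq, true_and] at h1 h2
      rw [h1.1, ih w₂ h1.2 h2]

end OpWord

theorem exists_append_of_lex {α : Type u} {r : α → α → Prop} {x y : List α}
    (hl : x.length = y.length) (h : List.Lex r x y) :
    ∃ p s t a b, x = p ++ a :: s ∧ y = p ++ b :: t ∧ r a b := by
  induction h with
  | nil => simp at hl
  | @cons a l₁ l₂ _ ih =>
    obtain ⟨p, s, t, c, d, h1, h2, h3⟩ := ih (by simpa using hl)
    exact ⟨a :: p, s, t, c, d, by simp [h1], by simp [h2], h3⟩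
  | @rel a l₁ b l₂ h => exact ⟨[], l₁, l₂, a, b, rfl, rfl, h⟩

theorem lex_of_append {α : Type u} {r : α → α → Prop} (p s t : List α) {a b : α} (h : r a b) :
    List.Lex r (p ++ a :: s) (p ++ b :: t) := by
  induction p with
  | nil => exact List.Lex.rel h
  | cons c p ih => exact List.Lex.cons ih

theorem shortlex_append {α : Type u} {r : α → α → Prop} (p s : List α) {a b : List α}
    (h : List.Shortlex r a b) : List.Shortlex r (p ++ a ++ s) (p ++ b ++ s) := by
  rcases List.shortlex_def.1 h with h | ⟨hl, h⟩
  · exact List.Shortlex.of_length_lt (by simpa using h)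
  · obtain ⟨p', s', t', a', b', rfl, rfl, hab⟩ := exists_append_of_lex hl h
    refine List.Shortlex.of_lex (by simpa using hl) ?_
    have := lex_of_append (p ++ p') (s' ++ s) (t' ++ s) hab
    simpa using this

/-- If all entries of two lists of the same length are comparable, then the lists are equal or
differ first at some comparable entries. -/
theorem eq_or_split {α : Type u} {r : α → α → Prop} : ∀ (x y : List α), x.length = y.length →
    (∀ a ∈ x, ∀ b, r a b ∨ a = b ∨ r b a) →
    x = y ∨ ∃ p s t a b, x = p ++ a :: s ∧ y = p ++ b :: t ∧ (r a b ∨ r b a)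
  | [], [], _, _ => Or.inl rfl
  | [], _ :: _, h, _ => by simp at h
  | _ :: _, [], h, _ => by simp at h
  | a :: x, b :: y, h, H => by
    rcases H a (by simp) b with hab | rfl | hab
    · exact Or.inr ⟨[], x, y, a, b, rfl, rfl, Or.inl hab⟩
    · rcases eq_or_split x y (by simpa using h) (fun c hc => H c (by simp [hc])) with
        rfl | ⟨p, s, t, c, d, h1, h2, h3⟩
      · exact Or.inl rfl
      · exact Or.inr ⟨a :: p, s, t, c, d, by simp [h1], by simp [h2], h3⟩
    · exact Or.inr ⟨[], x, y, a, b, rfl, rfl, Or.inr hab⟩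

namespace OpWord

theorem dbLT_trichotomous {Z : Type u} [LinearOrder Z] (n : ℕ) : ∀ x : OpWord Z, degP x = n →
    ∀ y, DbLT x y ∨ x = y ∨ DbLT y x := by
  induction n using Nat.strong_induction_on with
  | _ n IH =>
  intro x hx y
  rcases lt_trichotomy (degP x) (degP y) with h | h | h
  · exact Or.inl (.of_degP h)
  · rcases lt_trichotomy (brackets x).length (brackets y).length with h' | h' | h'
    · exact Or.inl (.of_breadthP h h')
    · rcases eq_or_split (r := DbLT) (brackets x) (brackets y) h'
        (fun a ha b => IH _ (hx ▸ degP_lt_of_mem_brackets x a ha) a rfl b) with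
        e | ⟨p, s, t, a, b, h1, h2, h3 | h3⟩
      · rcases eq_or_split (r := List.Shortlex (· < ·)) (blocks x) (blocks y)
          (by rw [length_blocks, length_blocks, e])
          (fun a _ b => trichotomous_of (List.Shortlex (· < ·)) a b) with
          e' | ⟨p, s, t, a, b, h1, h2, h3 | h3⟩
        · exact Or.inr (Or.inl (eq_of_brackets_of_blocks x y e e'))
        · exact Or.inl (.of_blocks h e p s t a b h1 h2 h3)
        · exact Or.inr (Or.inr (.of_blocks h.symm e.symm p t s b a h2 h1 h3))
      · exact Or.inl (.of_brackets h h' p s t a b h1 h2 h3)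
      · exact Or.inr (Or.inr (.of_brackets h.symm h'.symm p t s b a h2 h1 h3))
    · exact Or.inr (Or.inr (.of_breadthP h.symm h'))
  · exact Or.inr (Or.inr (.of_degP h))

/-- The relation `<_db` restricted to words whose `P`-degree is below `n`. -/
def DbBelow {Z : Type u} [LinearOrder Z] (n : ℕ) (x y : OpWord Z) : Prop :=
  DbLT x y ∧ degP x < n ∧ degP y < n

theorem dbLT_degP_le {Z : Type u} [LinearOrder Z] {x y : OpWord Z} (h : DbLT x y) :
    degP x ≤ degP y := by
  cases h <;> omega

theorem dbBelow_wf {Z : Type u} [LinearOrder Z] [WellFoundedLT Z] (n : ℕ) :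
    WellFounded (DbBelow (Z := Z) n) := by
  induction n with
  | zero => exact ⟨fun a => ⟨_, fun b h => by simp [DbBelow] at h⟩⟩
  | succ n ih =>
    let R : OpWord Z → OpWord Z → Prop :=
      InvImage (Prod.Lex (· < ·) (Prod.Lex (List.Shortlex (DbBelow n))
        (List.Shortlex (List.Shortlex (· < ·)))))
        (fun x => (degP x, brackets x, blocks x))
    have hR : WellFounded R := InvImage.wf _
      (WellFounded.prod_lex wellFounded_lt (WellFounded.prod_lex (List.Shortlex.wf ih)
        (List.Shortlex.wf (List.Shortlex.wf wellFounded_lt))))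
    refine Subrelation.wf (r := R) ?_ hR
    rintro x y ⟨h, hx, hy⟩
    change Prod.Lex _ _ (degP x, brackets x, blocks x) (degP y, brackets y, blocks y)
    cases h with
    | of_degP h => exact Prod.Lex.left _ _ h
    | of_breadthP h h' =>
      rw [h]
      exact Prod.Lex.right _ (Prod.Lex.left _ _ (List.Shortlex.of_length_lt h'))
    | of_brackets h h' p s t a b h1 h2 hab =>
      rw [h]
      refine Prod.Lex.right _ (Prod.Lex.left _ _ (List.Shortlex.of_lex h' ?_))
      rw [h1, h2]
      have ha := degP_lt_of_mem_brackets x a (by simp [h1])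
      have hb := degP_lt_of_mem_brackets y b (by simp [h2])
      exact lex_of_append p s t ⟨hab, by omega, by omega⟩
    | of_blocks h h' p s t a b h1 h2 hab =>
      rw [h, h']
      refine Prod.Lex.right _ (Prod.Lex.right _ (List.Shortlex.of_lex ?_ ?_))
      · rw [length_blocks, length_blocks, h']
      · rw [h1, h2]
        exact lex_of_append p s t hab

theorem dbLT_wf {Z : Type u} [LinearOrder Z] [WellFoundedLT Z] :
    WellFounded (DbLT (Z := Z)) := by
  refine ⟨fun a => ?_⟩
  have key : ∀ n (a : OpWord Z), degP a < n → Acc DbLT a := by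
    intro n a
    induction a using (dbBelow_wf (Z := Z) n).induction with
    | _ a ih =>
    intro ha
    refine ⟨_, fun b hb => ?_⟩
    have hb' : degP b < n := lt_of_le_of_lt (dbLT_degP_le hb) ha
    exact ih b ⟨hb, hb', ha⟩ hb'
  exact key _ a (Nat.lt_succ_self _)

instance {Z : Type u} [LinearOrder Z] [WellFoundedLT Z] : IsWellOrder (OpWord Z) DbLT where
  wf := dbLT_wf
  trichotomous a b h1 h2 := by
    rcases dbLT_trichotomous _ a rfl b with h | h | h
    · exact absurd h h1
    · exact h
    · exact absurd h h2

theorem dbLT_br {Z : Type u} [LinearOrder Z] {x y : OpWord Z} (h : DbLT x y) :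
    DbLT (br x) (br y) := by
  rcases (dbLT_degP_le h).lt_or_eq with h' | h'
  · exact .of_degP (by simpa [degP] using h')
  · exact .of_brackets (by simp [degP, h']) rfl [] [] [] x y rfl rfl h

theorem dbLT_mul_left {Z : Type u} [LinearOrder Z] (w : OpWord Z) {x y : OpWord Z}
    (h : DbLT x y) : DbLT (w * x) (w * y) := by
  cases h with
  | of_degP h => exact .of_degP (by simpa [degP_mul] using h)
  | of_breadthP h h' =>
    exact .of_breadthP (by simpa [degP_mul] using h) (by simpa [brackets_mul] using h')
  | of_brackets h h' p s t a b h1 h2 hab =>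
    exact .of_brackets (by simpa [degP_mul] using h) (by simpa [brackets_mul] using h')
      (brackets w ++ p) s t a b (by simp [brackets_mul, h1]) (by simp [brackets_mul, h2]) hab
  | of_blocks h h' p s t a b h1 h2 hab =>
    obtain ⟨i, j, l, r, e1, e2, e3⟩ := blocks_mul w x
    obtain ⟨i', j', l', r', e1', e2', e3'⟩ := blocks_mul w y
    obtain ⟨rfl, e⟩ := List.append_inj' (e1.symm.trans e1') rfl
    obtain rfl : l = l' := by simpa using e
    have hd : degP (w * x) = degP (w * y) := by simpa [degP_mul] using h
    have hb : brackets (w * x) = brackets (w * y) := by rw [brackets_mul, brackets_mul, h']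
    cases p with
    | nil =>
      simp only [h1, h2, List.nil_append, List.cons.injEq] at e2 e2'
      obtain ⟨rfl, rfl⟩ := e2
      obtain ⟨rfl, rfl⟩ := e2'
      exact .of_blocks hd hb i s t (l ++ a) (l ++ b) e3 e3'
        (by simpa using shortlex_append l [] hab)
    | cons c p =>
      simp only [h1, h2, List.cons_append, List.cons.injEq] at e2 e2'
      obtain ⟨rfl, rfl⟩ := e2
      obtain ⟨rfl, rfl⟩ := e2'
      exact .of_blocks hd hb (i ++ (l ++ c) :: p) s t a b (by simp [e3]) (by simp [e3']) hab

theorem dbLT_mul_right {Z : Type u} [LinearOrder Z] (w : OpWord Z) {x y : OpWord Z}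
    (h : DbLT x y) : DbLT (x * w) (y * w) := by
  cases h with
  | of_degP h => exact .of_degP (by simpa [degP_mul] using h)
  | of_breadthP h h' =>
    exact .of_breadthP (by simpa [degP_mul] using h) (by simpa [brackets_mul] using h')
  | of_brackets h h' p s t a b h1 h2 hab =>
    exact .of_brackets (by simpa [degP_mul] using h) (by simpa [brackets_mul] using h')
      p (s ++ brackets w) (t ++ brackets w) a b (by simp [brackets_mul, h1])
      (by simp [brackets_mul, h2]) hab
  | of_blocks h h' p s t a b h1 h2 hab =>
    obtain ⟨i, j, l, r, e1, e2, e3⟩ := blocks_mul x w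
    obtain ⟨i', j', l', r', e1', e2', e3'⟩ := blocks_mul y w
    rw [e2] at e2'
    simp only [List.cons.injEq] at e2'
    obtain ⟨rfl, rfl⟩ := e2'
    have hd : degP (x * w) = degP (y * w) := by simpa [degP_mul] using h
    have hb : brackets (x * w) = brackets (y * w) := by rw [brackets_mul, brackets_mul, h']
    have hl : s.length = t.length := by
      have hx := length_blocks x
      have hy := length_blocks y
      rw [h1] at hx
      rw [h2, ← h'] at hy
      simp only [List.length_append, List.length_cons] at hx hy
      omega
    rcases List.eq_nil_or_concat s with rfl | ⟨s, c, rfl⟩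
    · obtain rfl : t = [] := by simpa using hl.symm
      obtain ⟨hi, e⟩ := List.append_inj' (e1.symm.trans h1) rfl
      obtain ⟨hi', e'⟩ := List.append_inj' (e1'.symm.trans h2) rfl
      rw [hi] at e3
      rw [hi'] at e3'
      obtain rfl : l = a := by simpa using e
      obtain rfl : l' = b := by simpa using e'
      exact .of_blocks hd hb p j j (l ++ r) (l' ++ r) e3 e3'
        (by simpa using shortlex_append [] r hab)
    · rcases List.eq_nil_or_concat t with rfl | ⟨t, d, rfl⟩
      · simp at hl
      obtain ⟨rfl, e⟩ := List.append_inj' (s₁ := i) (s₂ := p ++ a :: s) (t₁ := [l]) (t₂ := [c])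
        (by rw [← e1, h1]; simp) rfl
      obtain ⟨rfl, e'⟩ := List.append_inj' (s₁ := i') (s₂ := p ++ b :: t) (t₁ := [l']) (t₂ := [d])
        (by rw [← e1', h2]; simp) rfl
      exact .of_blocks hd hb p (s ++ (l ++ r) :: j) (t ++ (l' ++ r) :: j) a b
        (by simp [e3]) (by simp [e3']) hab

theorem dbLT_plug {Z : Type u} [LinearOrder Z] (q : StarWord Z) {x y : OpWord Z}
    (h : DbLT x y) : DbLT (q.plug x) (q.plug y) := by
  induction q with
  | star => exact h
  | starMul w => exact dbLT_mul_right w h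
  | br q ih => exact dbLT_br ih
  | brMul q w ih => exact dbLT_mul_right w (dbLT_br ih)
  | varMulStar z q ih => exact dbLT_mul_left (var z) ih
  | brMulStar w q ih => exact dbLT_mul_left (br w) ih

end OpWord

/-! ### Contexts in the free semigroup -/

/-- The word `a · w · b`, where `a` and `b` are possibly empty words. -/
def wordPlug {Z : Type u} : List Z × List Z → FreeSemigroup Z → FreeSemigroup Z
  | ([], b), w => ⟨w.head, w.tail ++ b⟩
  | (z :: a, b), w => ⟨z, a ++ (w.head :: w.tail) ++ b⟩

theorem wordPlug_toList {Z : Type u} (c : List Z × List Z) (w : FreeSemigroup Z) :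
    (wordPlug c w).head :: (wordPlug c w).tail = c.1 ++ (w.head :: w.tail) ++ c.2 := by
  obtain ⟨_ | ⟨z, a⟩, b⟩ := c <;> simp [wordPlug]

/-- The strict degree-lexicographic order on the free semigroup. -/
def DlexLT {Z : Type u} [LinearOrder Z] (x y : FreeSemigroup Z) : Prop :=
  List.Shortlex (· < ·) (x.head :: x.tail) (y.head :: y.tail)

/-! ### Monomial orders, leading monomials and Gröbner-Shirshov bases

The notions for the free semigroup and for the free operated semigroup are instances of the same
definitions, for a semigroup `S` of monomials and a map `plug : C → S → S`, where `C` is the set of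
words with one occurrence of `⋆` and `plug q u` is `q|_u`. -/

/-- A monomial order: a well order `<` with `u < v → q|_u < q|_v`. -/
structure MonoOrder {S : Type u} {C : Type u} (plug : C → S → S) where
  /-- The strict order. -/
  lt : S → S → Prop
  isWellOrder : IsWellOrder S lt
  plug_lt_plug : ∀ (q : C) (x y : S), lt x y → lt (plug q x) (plug q y)

/-- The monomial order `≤_db` on the free operated semigroup. -/
def dbOrder (Z : Type u) [LinearOrder Z] [WellFoundedLT Z] :
    MonoOrder (StarWord.plug (Z := Z)) where
  lt := OpWord.DbLT
  isWellOrder := inferInstance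
  plug_lt_plug q _ _ h := OpWord.dbLT_plug q h

/-- The monomial order `≤_dlex` on the free semigroup. -/
def dlexOrder (Z : Type u) [LinearOrder Z] [WellFoundedLT Z] :
    MonoOrder (wordPlug (Z := Z)) where
  lt := DlexLT
  isWellOrder :=
    { wf := InvImage.wf (fun x : FreeSemigroup Z => x.head :: x.tail)
        (List.Shortlex.wf wellFounded_lt)
      trichotomous := fun x y h1 h2 => by
        rcases trichotomous_of (List.Shortlex (· < ·)) (x.head :: x.tail) (y.head :: y.tail) with
          h | h | h
        · exact absurd h h1
        · obtain ⟨a, l⟩ := x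
          obtain ⟨b, m⟩ := y
          simpa using h
        · exact absurd h h2 }
  plug_lt_plug q x y h := by
    unfold DlexLT at *
    rw [wordPlug_toList, wordPlug_toList]
    exact shortlex_append _ _ h

/-- `m` is the leading monomial of `f` (so `f ≠ 0`). -/
def IsLeading {ι : Type u} {k : Type v} [Field k] (lt : ι → ι → Prop) (f : ι →₀ k) (m : ι) :
    Prop :=
  m ∈ f.support ∧ ∀ m' ∈ f.support, m' ≠ m → lt m' m

/-- `h` is trivial modulo `(T, w)`: it is a linear combination of elements `q|_s` with `s ∈ T` and
`q|_{s̄} < w`. -/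
def IsTrivialMod {S : Type u} {C : Type u} {k : Type v} [Field k] [Semigroup S] {plug : C → S → S}
    (O : MonoOrder plug) (T : Set (MonoidAlgebra k S)) (w : S) (h : MonoidAlgebra k S) : Prop :=
  h ∈ Submodule.span k {p : MonoidAlgebra k S | ∃ s ∈ T, ∃ (q : C) (m : S),
    IsLeading O.lt s.coeff m ∧ O.lt (plug q m) w ∧ p = MonoidAlgebra.mapDomain (plug q) s}

/-- A subset `T` of `k S` is a Gröbner-Shirshov basis with respect to a monomial order: for all
`f, g ∈ T`, made monic, with leading monomials `a, b`, every intersection composition `f u - v g`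
with respect to `w = a u = v b`, where `max |a| |b| < |w| < |a| + |b|`, is trivial modulo `(T, w)`,
and so is every inclusion composition `f - q|_g` with respect to `w = a = q|_b`. -/
def IsGSBasis {S : Type u} {C : Type u} {k : Type v} [Field k] [Semigroup S] {plug : C → S → S}
    (O : MonoOrder plug) (breadth : S → ℕ) (T : Set (MonoidAlgebra k S)) : Prop :=
  ∀ f ∈ T, ∀ g ∈ T, ∀ a b : S, IsLeading O.lt f.coeff a → IsLeading O.lt g.coeff b →
    (∀ w u v : S, w = a * u → w = v * b →
      max (breadth a) (breadth b) < breadth w → breadth w < breadth a + breadth b →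
      IsTrivialMod O T w
        ((f.coeff a)⁻¹ • f * MonoidAlgebra.single u 1 -
          MonoidAlgebra.single v 1 * (g.coeff b)⁻¹ • g)) ∧
    (∀ q : C, a = plug q b →
      IsTrivialMod O T a
        ((f.coeff a)⁻¹ • f - MonoidAlgebra.mapDomain (plug q) ((g.coeff b)⁻¹ • g)))

/-! ### Ideals -/

/-- A two-sided ideal of the (nonunital) algebra `k S`. -/
def IsAlgIdeal {S : Type u} {k : Type v} [Field k] [Semigroup S]
    (I : Submodule k (MonoidAlgebra k S)) : Prop :=
  ∀ x ∈ I, ∀ a : MonoidAlgebra k S, a * x ∈ I ∧ x * a ∈ I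

/-- The two-sided ideal of `k S` generated by `T`. -/
def idealSpan {S : Type u} {k : Type v} [Field k] [Semigroup S] (T : Set (MonoidAlgebra k S)) :
    Submodule k (MonoidAlgebra k S) :=
  sInf {I | IsAlgIdeal I ∧ T ⊆ I}

/-- The operator of the free nonunital operated algebra: the linear extension of `u ↦ ⌊u⌋`. -/
def operator {k : Type v} [Field k] {Z : Type u} (f : MonoidAlgebra k (OpWord Z)) :
    MonoidAlgebra k (OpWord Z) :=
  MonoidAlgebra.mapDomain OpWord.br f

/-- The operated ideal generated by `T`: the least two-sided ideal that contains `T` and is closed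
under the operator. -/
def operatedIdealSpan {k : Type v} [Field k] {Z : Type u} (T : Set (MonoidAlgebra k (OpWord Z))) :
    Submodule k (MonoidAlgebra k (OpWord Z)) :=
  sInf {I | IsAlgIdeal I ∧ (∀ x ∈ I, operator x ∈ I) ∧ T ⊆ I}

/-- `G` is a Gröbner-Shirshov basis of the ideal `I` of the free algebra `k S(Z)` with respect to
the degree-lexicographic order. -/
def IsGSBasisOf {k : Type v} [Field k] {Z : Type u} [LinearOrder Z] [WellFoundedLT Z]
    (G : Set (MonoidAlgebra k (FreeSemigroup Z)))
    (I : Submodule k (MonoidAlgebra k (FreeSemigroup Z))) : Prop :=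
  IsGSBasis (dlexOrder Z) FreeSemigroup.length G ∧ idealSpan G = I

/-- `T` is an operated Gröbner-Shirshov basis of the operated ideal `I` of the free operated algebra
with respect to the order `≤_db`. -/
def IsOperatedGSBasisOf {k : Type v} [Field k] {Z : Type u} [LinearOrder Z] [WellFoundedLT Z]
    (T : Set (MonoidAlgebra k (OpWord Z))) (I : Submodule k (MonoidAlgebra k (OpWord Z))) : Prop :=
  IsGSBasis (dbOrder Z) OpWord.breadth T ∧ operatedIdealSpan T = I

/-! ### Operated polynomial identities -/

/-- `S_φ(𝔖(Z))`: the set of all `φ(u₁, …, uₙ)` with `u₁, …, uₙ` monomials. -/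
def instances {k : Type v} [Field k] {X : Type} (φ : MonoidAlgebra k (OpWord X)) (Z : Type u) :
    Set (MonoidAlgebra k (OpWord Z)) :=
  {p | ∃ σ : X → OpWord Z, p = MonoidAlgebra.mapDomain (OpWord.subst σ) φ}

/-- The operated polynomial identity `⌊xy⌋ - λ xy`. -/
def phi4 {k : Type v} [Field k] (lam : k) : MonoidAlgebra k (OpWord (Fin 2)) :=
  MonoidAlgebra.single (.br (.var 0 * .var 1)) 1 - MonoidAlgebra.single (.var 0 * .var 1) lam

/-! ### Linear parts and self-reduced bases -/

/-- The inclusion of the free semigroup in the free operated semigroup. -/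
def ofWord {Z : Type u} : FreeSemigroup Z →ₙ* OpWord Z := FreeSemigroup.lift OpWord.var

/-- The inclusion of the free algebra in the free operated algebra. -/
def ofFree {k : Type v} [Field k] {Z : Type u} (f : MonoidAlgebra k (FreeSemigroup Z)) :
    MonoidAlgebra k (OpWord Z) :=
  MonoidAlgebra.mapDomain ofWord f

/-- The inclusion of the vector space `k Z` in the free operated algebra. -/
def ofLinear {k : Type v} [Field k] {Z : Type u} (f : Z →₀ k) : MonoidAlgebra k (OpWord Z) :=
  .ofCoeff (f.mapDomain OpWord.var)

theorem freeSemigroup_of_injective (Z : Type u) :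
    Function.Injective (FreeSemigroup.of : Z → FreeSemigroup Z) := fun _ _ h =>
  congrArg FreeSemigroup.head h

/-- The projection `π` of the free algebra onto `k Z`: the linear part of a polynomial. -/
def linearPart {k : Type v} [Field k] {Z : Type u} (f : MonoidAlgebra k (FreeSemigroup Z)) :
    Z →₀ k :=
  f.coeff.comapDomain FreeSemigroup.of (freeSemigroup_of_injective Z).injOn

/-- `f` is linearly reduced with respect to `T`: no basis element occurring in `f` is the leading
basis element of an element of `T`. -/
def IsLinearlyReduced {ι : Type u} {k : Type v} [Field k] [LinearOrder ι] (T : Set (ι →₀ k))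
    (f : ι →₀ k) : Prop :=
  ∀ i ∈ f.support, ∀ t ∈ T, ¬ IsLeading (· < ·) t i

/-- Each element `s` of `T` has a leading basis element, with coefficient `1`, and is linearly
reduced with respect to `T \ {s}`. -/
def IsLinearlySelfReduced {ι : Type u} {k : Type v} [Field k] [LinearOrder ι] (T : Set (ι →₀ k)) :
    Prop :=
  ∀ s ∈ T, (∃ i, IsLeading (· < ·) s i ∧ s i = 1) ∧ IsLinearlyReduced (T \ {s}) s

/-- `B` is a linearly self-reduced basis of the subspace `V`. -/
def IsSelfReducedBasis {ι : Type u} {k : Type v} [Field k] [LinearOrder ι] (B : Set (ι →₀ k))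
    (V : Submodule k (ι →₀ k)) : Prop :=
  IsLinearlySelfReduced B ∧ LinearIndepOn k id B ∧ Submodule.span k B = V

/-- The set of all `⌊g⌋ - λ g` with `g ∈ B`. -/
def linearRelations {k : Type v} [Field k] {Z : Type u} (lam : k) (B : Set (Z →₀ k)) :
    Set (MonoidAlgebra k (OpWord Z)) :=
  {p | ∃ g ∈ B, p = operator (ofLinear g) - lam • ofLinear g}

end OperatedGS

end

/-! Write `Φ f = ⌊f⌋ - λ f` (`relMap`). The generators are `Φ w` for monomials `w` of breadth at
least 2, the elements of `G`, and `Φ h` for `h ∈ B`. Since `m < ⌊m⌋`, the leading monomial of `Φ f`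
is `⌊m⌋` when that of `f` is `m`. So every leading monomial is either bracket-free (from `G`) or a
single bracket, of breadth 1.

A word of breadth 1 has no proper overlap, so intersection compositions arise only inside `G`; they
involve no bracket and are resolved in the free algebra. The same holds for inclusions into an
element of `G`. An inclusion at the top of a bracket is a composition of an element with itself,
because equal bracketed leading monomials force equal elements. What remains is an inclusion inside
the bracket, `⌊m⌋ = ⌊q|_b⌋`, whose composition is `Φ r - λ q|_g` with `r = f - q|_g` for monic `g`.
The second term is trivial since `m < ⌊m⌋`. The monomials of `r` are below `m`. Expanding `Φ r`,
those of breadth at least 2 give instances of `phi4`, and the linear part lies in `k π(G)`, so it is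
handled by the `Φ h`. Here self-reducedness matters: an element of the span of `B` needs only those
`h ∈ B` whose leading variable occurs in it, so no term exceeds the bound (`mem_span_leading`,
`isTrivialMod_relMap`).

The ideals agree because `Φ (π g) = Φ g - Φ (g - π g)`, where `g - π g` has only monomials of
breadth at least 2 (`operatedIdealSpan_eq`). Existence and uniqueness of `B` are Gaussian
elimination along a well-order (`exists_reduced`, `IsSelfReducedBasis.subset`). -/

namespace OperatedGS

/-! ### Linearly self-reduced bases of a subspace. -/

section SelfReduced

variable {ι : Type u} {k : Type v} [Field k]

theorem IsLeading.unique {lt : ι → ι → Prop} [Std.Asymm lt] {f : ι →₀ k} {i j : ι}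
    (hi : IsLeading lt f i) (hj : IsLeading lt f j) : i = j := by
  by_contra h
  exact Std.Asymm.asymm _ _ (hi.2 j hj.1 (Ne.symm h)) (hj.2 i hi.1 h)

theorem IsLeading.apply_ne_zero {lt : ι → ι → Prop} {f : ι →₀ k} {i : ι}
    (hi : IsLeading lt f i) : f i ≠ 0 :=
  Finsupp.mem_support_iff.1 hi.1

variable [LinearOrder ι]

theorem exists_isLeading {f : ι →₀ k} (hf : f ≠ 0) : ∃ i, IsLeading (· < ·) f i := by
  have h : f.support.Nonempty := Finsupp.support_nonempty_iff.2 hf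
  exact ⟨f.support.max' h, f.support.max'_mem h,
    fun j hj hne => lt_of_le_of_ne (f.support.le_max' j hj) hne⟩

theorem IsLeading.le {f : ι →₀ k} {i j : ι} (hi : IsLeading (· < ·) f i) (hj : f j ≠ 0) :
    j ≤ i := by
  by_cases h : j = i
  · exact h.le
  · exact (hi.2 j (Finsupp.mem_support_iff.2 hj) h).le

/-- The leading basis elements of the elements of a subspace. -/
def leads (V : Submodule k (ι →₀ k)) : Set ι :=
  {i | ∃ f ∈ V, IsLeading (· < ·) f i}

/-- A nonzero element of `V` does not vanish at its own leading basis element. This reduces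
equalities in `V` to comparing coordinates at `leads V`. -/
theorem eq_zero_of_apply_leads {V : Submodule k (ι →₀ k)} {f : ι →₀ k} (hf : f ∈ V)
    (h : ∀ i ∈ leads V, f i = 0) : f = 0 := by
  by_contra hne
  obtain ⟨i, hi⟩ := exists_isLeading hne
  exact hi.apply_ne_zero (h i ⟨f, hf, hi⟩)

/-- Every leading basis element `i` of `V` is the leading basis element of an element of `V`
in which no other leading basis element of `V` occurs. -/
theorem exists_reduced [WellFoundedLT ι] (V : Submodule k (ι →₀ k)) (i : ι) (hi : i ∈ leads V) :
    ∃ f ∈ V, IsLeading (· < ·) f i ∧ f i = 1 ∧ ∀ j ∈ leads V, j ≠ i → f j = 0 := by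
  classical
  induction i using WellFoundedLT.induction with
  | _ i ih =>
  obtain ⟨f, hf, hfi⟩ := hi
  choose! g hgV hgl hg1 hg0 using ih
  -- Clear from `f` the smaller leading basis elements, using the reduced elements `g j` supplied by
  -- induction.
  set P := f.support.filter (fun j => j ∈ leads V ∧ j < i) with hP
  have hPi : ∀ j ∈ P, j < i ∧ j ∈ leads V := fun j hj => by
    simp only [hP, Finset.mem_filter] at hj
    exact ⟨hj.2.2, hj.2.1⟩
  set r := f - ∑ j ∈ P, f j • g j with hr
  have hrV : r ∈ V := V.sub_mem hf (V.sum_mem fun j hj =>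
    V.smul_mem _ (hgV j (hPi j hj).1 (hPi j hj).2))
  have happ : ∀ m, r m = f m - ∑ j ∈ P, f j * g j m := fun m => by
    simp [hr]
  -- Each `g j` that is subtracted has leading element `j < i`, so nothing changes from `i` upwards.
  have hge : ∀ m, i ≤ m → r m = f m := fun m hm => by
    rw [happ, Finset.sum_eq_zero, sub_zero]
    intro j hj
    have hji := hPi j hj
    have : g j m = 0 := by
      by_contra hne
      exact absurd ((hgl j hji.1 hji.2).le hne) (not_le.2 (hji.1.trans_le hm))
    rw [this, mul_zero]
  have hri : r i = f i := hge i le_rfl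
  have hzero : ∀ m ∈ leads V, m ≠ i → r m = 0 := by
    intro m hm hne
    rcases lt_or_gt_of_ne hne with hlt | hgt
    · by_cases hfm : f m = 0
      · rw [happ, hfm, Finset.sum_eq_zero, sub_zero]
        intro j hj
        have hji := hPi j hj
        have : m ≠ j := by
          rintro rfl
          simp [hP, hfm] at hj
        rw [hg0 j hji.1 hji.2 m hm this, mul_zero]
      · have hmP : m ∈ P := by simp [hP, hfm, hm, hlt]
        rw [happ, Finset.sum_eq_single_of_mem m hmP, hg1 m hlt hm, mul_one, sub_self]
        intro j hj hjm
        have hji := hPi j hj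
        rw [hg0 j hji.1 hji.2 m hm hjm.symm, mul_zero]
    · rw [hge m hgt.le]
      by_contra hfm
      exact absurd (hfi.le hfm) (not_le.2 hgt)
  have hne := hfi.apply_ne_zero
  refine ⟨(f i)⁻¹ • r, V.smul_mem _ hrV, ⟨?_, ?_⟩, ?_, ?_⟩
  · simp [hri, hne]
  · intro m hm hmi
    rw [Finsupp.mem_support_iff] at hm
    have hrm : r m ≠ 0 := fun h => hm (by simp [h])
    by_contra hlt
    have hle : i ≤ m := not_lt.1 hlt
    rw [hge m hle] at hrm
    exact hmi (le_antisymm (hfi.le hrm) hle)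
  · simp [hri, hne]
  · intro j hj hji
    simp [hzero j hj hji]

theorem IsLinearlySelfReduced.apply_eq_zero {B : Set (ι →₀ k)} (hB : IsLinearlySelfReduced B)
    {s t : ι →₀ k} (hs : s ∈ B) (ht : t ∈ B) (hne : t ≠ s) {i : ι}
    (hi : IsLeading (· < ·) s i) : t i = 0 := by
  by_contra h
  exact (hB t ht).2 i (Finsupp.mem_support_iff.2 h) s ⟨hs, hne.symm⟩ hi

theorem IsLinearlySelfReduced.apply_eq_one {B : Set (ι →₀ k)} (hB : IsLinearlySelfReduced B)
    {s : ι →₀ k} (hs : s ∈ B) {i : ι} (hi : IsLeading (· < ·) s i) : s i = 1 := by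
  obtain ⟨j, hj, h1⟩ := (hB s hs).1
  rwa [hi.unique hj]

/-- At the leading element of `s` every other member of `B` vanishes and `s` takes the value 1, so
coefficients can be read off as coordinates. Linear independence follows. -/
theorem IsLinearlySelfReduced.linearCombination_apply {B : Set (ι →₀ k)}
    (hB : IsLinearlySelfReduced B) {c : (ι →₀ k) →₀ k} (hc : (c.support : Set (ι →₀ k)) ⊆ B)
    {s : ι →₀ k} (hs : s ∈ B) {i : ι} (hi : IsLeading (· < ·) s i) :
    (Finsupp.linearCombination k id c) i = c s := by
  rw [Finsupp.linearCombination_apply, Finsupp.sum, Finsupp.finsetSum_apply,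
    Finset.sum_eq_single s]
  · simp [hB.apply_eq_one hs hi]
  · intro t ht hts
    simp [hB.apply_eq_zero hs (hc ht) hts hi]
  · intro h
    simp [Finsupp.notMem_support_iff.1 h]

theorem IsLinearlySelfReduced.linearIndepOn {B : Set (ι →₀ k)} (hB : IsLinearlySelfReduced B) :
    LinearIndepOn k id B := by
  rw [linearIndepOn_iff]
  intro c hc h0
  have hc' : (c.support : Set (ι →₀ k)) ⊆ B := (Finsupp.mem_supported k c).1 hc
  ext s
  by_contra hne
  have hs : s ∈ B := hc' (by simpa using hne)
  obtain ⟨i, hi, -⟩ := (hB s hs).1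
  have := hB.linearCombination_apply hc' hs hi
  rw [h0] at this
  exact hne this.symm

/-- An element of the span of a linearly self-reduced set is a combination of those elements whose
leading basis element occurs in it. -/
theorem IsLinearlySelfReduced.mem_span_leading {B : Set (ι →₀ k)} (hB : IsLinearlySelfReduced B)
    {f : ι →₀ k} (hf : f ∈ Submodule.span k B) :
    f ∈ Submodule.span k {h | h ∈ B ∧ ∃ i, IsLeading (· < ·) h i ∧ f i ≠ 0} := by
  rw [← Set.image_id B, Finsupp.mem_span_image_iff_linearCombination] at hf
  obtain ⟨c, hc, hcf⟩ := hf
  have hc' : (c.support : Set (ι →₀ k)) ⊆ B := (Finsupp.mem_supported k c).1 hc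
  have key : c.sum (fun h a => a • id h) ∈
      Submodule.span k {h | h ∈ B ∧ ∃ i, IsLeading (· < ·) h i ∧ f i ≠ 0} := by
    refine Submodule.sum_mem _ fun s hs => Submodule.smul_mem _ _ (Submodule.subset_span ?_)
    obtain ⟨i, hi, -⟩ := (hB s (hc' hs)).1
    refine ⟨hc' hs, i, hi, ?_⟩
    rw [← hcf, hB.linearCombination_apply hc' (hc' hs) hi]
    exact Finsupp.mem_support_iff.1 hs
  rwa [← Finsupp.linearCombination_apply, hcf] at key

theorem IsLinearlySelfReduced.exists_of_mem_leads {B : Set (ι →₀ k)}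
    (hB : IsLinearlySelfReduced B) {i : ι} (hi : i ∈ leads (Submodule.span k B)) :
    ∃ s ∈ B, IsLeading (· < ·) s i := by
  obtain ⟨f, hf, hfi⟩ := hi
  by_contra! hno
  have key : ∀ g ∈ Submodule.span k {h | h ∈ B ∧ ∃ i, IsLeading (· < ·) h i ∧ f i ≠ 0},
      g i = 0 := by
    intro g hg
    induction hg using Submodule.span_induction with
    | mem h hh =>
      obtain ⟨hhB, j, hj, hfj⟩ := hh
      by_contra hne
      -- `j` occurs in `f`, hence `j ≤ i`; and `i` occurs in `h`, whose leading element is `j`,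
      -- hence `i ≤ j`.
      have hij : i = j := le_antisymm (hj.le hne) (hfi.le hfj)
      exact hno h hhB (hij ▸ hj)
    | zero => rfl
    | add x y _ _ hx hy => simp [hx, hy]
    | smul a x _ hx => simp [hx]
  exact hfi.apply_ne_zero (key f (hB.mem_span_leading hf))

/-- Elements of `B` and `B'` with the same leading element agree at every leading basis element of
`V`: both are 1 at their own, and both are 0 at the others. So they coincide. -/
theorem IsSelfReducedBasis.subset {B B' : Set (ι →₀ k)} {V : Submodule k (ι →₀ k)}
    (hB : IsSelfReducedBasis B V) (hB' : IsSelfReducedBasis B' V) : B ⊆ B' := by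
  obtain ⟨hB, -, rfl⟩ := hB
  obtain ⟨hB', -, hV⟩ := hB'
  intro s hs
  have hsV := Submodule.subset_span (R := k) hs
  obtain ⟨i, hi, -⟩ := (hB s hs).1
  obtain ⟨s', hs', hi'⟩ := hB'.exists_of_mem_leads (i := i) (hV ▸ ⟨s, hsV, hi⟩)
  have hsV' : s' ∈ Submodule.span k B := hV ▸ Submodule.subset_span hs'
  have : s - s' = 0 := by
    refine eq_zero_of_apply_leads (Submodule.sub_mem _ hsV hsV') fun j hj => ?_
    by_cases hji : j = i
    · subst hji
      simp [hB.apply_eq_one hs hi, hB'.apply_eq_one hs' hi']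
    · obtain ⟨t, ht, htj⟩ := hB.exists_of_mem_leads hj
      obtain ⟨t', ht', htj'⟩ := hB'.exists_of_mem_leads (i := j) (hV ▸ hj)
      have h1 : s ≠ t := fun h => hji (htj.unique (h ▸ hi))
      have h2 : s' ≠ t' := fun h => hji (htj'.unique (h ▸ hi'))
      simp [hB.apply_eq_zero ht hs h1 htj, hB'.apply_eq_zero ht' hs' h2 htj']
  rwa [sub_eq_zero.1 this]

theorem exists_isSelfReducedBasis [WellFoundedLT ι] (V : Submodule k (ι →₀ k)) :
    ∃ B, IsSelfReducedBasis B V := by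
  classical
  choose! g hgV hgl hg1 hg0 using exists_reduced V
  have hB : IsLinearlySelfReduced (g '' leads V) := by
    rintro _ ⟨i, hi, rfl⟩
    refine ⟨⟨i, hgl i hi, hg1 i hi⟩, ?_⟩
    rintro j hj _ ⟨⟨j', hj', rfl⟩, hne⟩ hlead
    obtain rfl : j = j' := hlead.unique (hgl j' hj')
    have hji : j ≠ i := by
      rintro rfl
      exact hne rfl
    exact Finsupp.mem_support_iff.1 hj (hg0 i hi j hj' hji)
  refine ⟨g '' leads V, hB, hB.linearIndepOn, le_antisymm ?_ ?_⟩
  · rw [Submodule.span_le]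
    rintro _ ⟨i, hi, rfl⟩
    exact hgV i hi
  · intro f hf
    set P := f.support.filter (· ∈ leads V) with hP
    have hPl : ∀ j ∈ P, j ∈ leads V := fun j hj => (Finset.mem_filter.1 hj).2
    have h0 : f - ∑ j ∈ P, f j • g j = 0 := by
      refine eq_zero_of_apply_leads
        (V.sub_mem hf (V.sum_mem fun j hj => V.smul_mem _ (hgV j (hPl j hj)))) fun m hm => ?_
      simp only [Finsupp.coe_sub, Pi.sub_apply, Finsupp.finsetSum_apply, Finsupp.coe_smul,
        Pi.smul_apply, smul_eq_mul]
      rw [Finset.sum_eq_single m]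
      · simp [hg1 m hm]
      · intro j hj hjm
        rw [hg0 j (hPl j hj) m hm hjm.symm, mul_zero]
      · intro hmP
        have : f m = 0 := by simpa [hP, hm] using hmP
        simp [this]
    rw [sub_eq_zero.1 h0]
    exact Submodule.sum_mem _ fun j hj =>
      Submodule.smul_mem _ _ (Submodule.subset_span ⟨j, hPl j hj, rfl⟩)

theorem existsUnique_isSelfReducedBasis [WellFoundedLT ι] (V : Submodule k (ι →₀ k)) :
    ∃! B, IsSelfReducedBasis B V := by
  obtain ⟨B, hB⟩ := exists_isSelfReducedBasis V
  exact ⟨B, hB, fun B' hB' => (hB'.subset hB).antisymm (hB.subset hB')⟩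

end SelfReduced

end OperatedGS

/-! ### Letters and breadth; bracket-free words inside the operated semigroup. -/

namespace OperatedGS

namespace OpWord

variable {Z : Type u}

/-- The list of the letters of a word. -/
def letters : OpWord Z → List (Z ⊕ OpWord Z)
  | var z => [.inl z]
  | br w => [.inr w]
  | varMul z w => .inl z :: letters w
  | brMul w' w => .inr w' :: letters w

theorem letters_mul (a b : OpWord Z) : letters (a * b) = letters a ++ letters b := by
  change letters (mul a b) = _
  induction a with
  | var z => simp [mul, letters]
  | br w _ => simp [mul, letters]
  | varMul z w ih => simp [mul, letters, ih]
  | brMul w' w _ ih => simp [mul, letters, ih]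

theorem length_letters (a : OpWord Z) : (letters a).length = breadth a := by
  induction a with
  | var z => rfl
  | br w _ => rfl
  | varMul z w ih => simp [letters, breadth, ih]
  | brMul w' w _ ih => simp [letters, breadth, ih]

theorem degP_eq_zero_iff (a : OpWord Z) : degP a = 0 ↔ ∀ l ∈ letters a, l.isLeft := by
  induction a with
  | var z => simp [letters, degP]
  | br w _ => simp [letters, degP]
  | varMul z w ih => simp [letters, degP, ih]
  | brMul w' w _ ih => simp [letters, degP]

theorem breadth_mul (a b : OpWord Z) : breadth (a * b) = breadth a + breadth b := by
  rw [← length_letters, letters_mul, List.length_append, length_letters, length_letters]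

theorem breadth_pos (a : OpWord Z) : 0 < breadth a := by
  cases a <;> simp [breadth]

theorem two_le_breadth_iff (w : OpWord Z) :
    2 ≤ breadth w ↔ (∀ z, w ≠ var z) ∧ ∀ x, w ≠ br x := by
  cases w with
  | var z => simp [breadth]
  | br w => simp [breadth]
  | varMul z w => simpa [breadth] using Nat.succ_le_of_lt (breadth_pos w)
  | brMul w' w => simpa [breadth] using Nat.succ_le_of_lt (breadth_pos w)

theorem exists_eq_mul {w : OpWord Z} (h : 2 ≤ breadth w) : ∃ a b, w = a * b := by
  cases w with
  | var z => simp [breadth] at h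
  | br w => simp [breadth] at h
  | varMul z w => exact ⟨_, _, varMul_eq z w⟩
  | brMul w' w => exact ⟨_, _, brMul_eq w' w⟩

theorem two_le_breadth_mul (a b : OpWord Z) : 2 ≤ breadth (a * b) := by
  have := breadth_pos a
  have := breadth_pos b
  rw [breadth_mul]
  omega

/-- The bound on the breadth makes `u` shorter than `b`. Both are suffixes of the same word, so `u`
is a suffix of the bracket-free word `b`. -/
theorem degP_eq_zero_of_overlap {a u v b : OpWord Z} (h : a * u = v * b)
    (hlt : breadth (a * u) < breadth a + breadth b) (hb : degP b = 0) : degP u = 0 := by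
  rw [breadth_mul] at hlt
  have hu : letters u <:+ letters (a * u) := by
    rw [letters_mul]
    exact List.suffix_append _ _
  have hb' : letters b <:+ letters (a * u) := by
    rw [h, letters_mul]
    exact List.suffix_append _ _
  have hs := List.suffix_of_suffix_length_le hu hb'
    (by rw [length_letters, length_letters]; omega)
  rw [degP_eq_zero_iff] at hb ⊢
  exact fun l hl => hb l (hs.mem hl)

theorem dbLT_var [LinearOrder Z] {x y : Z} (h : x < y) : DbLT (var x) (var y) :=
  .of_blocks rfl rfl [] [] [] [x] [y] rfl rfl (.of_lex rfl (.rel h))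

theorem dbLT_br_self [LinearOrder Z] (w : OpWord Z) : DbLT w (br w) :=
  .of_degP (by simp [degP])

end OpWord

open OpWord

variable {Z : Type u}

theorem ofWord_of (z : Z) : ofWord (FreeSemigroup.of z) = var z := rfl

theorem ofWord_of_mul (z : Z) (w : FreeSemigroup Z) :
    ofWord (FreeSemigroup.of z * w) = varMul z (ofWord w) := by
  rw [map_mul, ofWord_of, varMul_eq]

theorem degP_ofWord (w : FreeSemigroup Z) : degP (ofWord w) = 0 := by
  induction w using FreeSemigroup.recOnMul with
  | ih1 z => rfl
  | ih2 z w _ ih => rw [ofWord_of_mul, degP, ih]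

theorem brackets_ofWord (w : FreeSemigroup Z) : brackets (ofWord w) = [] := by
  induction w using FreeSemigroup.recOnMul with
  | ih1 z => rfl
  | ih2 z w _ ih => rw [ofWord_of_mul, brackets, ih]

theorem blocks_ofWord (w : FreeSemigroup Z) : blocks (ofWord w) = [w.head :: w.tail] := by
  induction w using FreeSemigroup.recOnMul with
  | ih1 z => rfl
  | ih2 z w _ ih => rw [ofWord_of_mul, blocks, ih]; rfl

theorem breadth_ofWord (w : FreeSemigroup Z) : breadth (ofWord w) = w.length := by
  induction w using FreeSemigroup.recOnMul with
  | ih1 z => rfl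
  | ih2 z w _ ih =>
    rw [ofWord_of_mul, breadth, ih, FreeSemigroup.length_mul, add_comm]
    rfl

theorem ofWord_injective : Function.Injective (ofWord : FreeSemigroup Z → OpWord Z) := by
  intro x y h
  have := congrArg blocks h
  rw [blocks_ofWord, blocks_ofWord] at this
  obtain ⟨a, l⟩ := x
  obtain ⟨b, m⟩ := y
  simpa using this

theorem var_injective : Function.Injective (var : Z → OpWord Z) := fun _ _ h => by
  simpa using h

theorem br_injective : Function.Injective (br : OpWord Z → OpWord Z) := fun _ _ h => by
  simpa using h

theorem exists_ofWord {w : OpWord Z} (h : degP w = 0) : ∃ m, w = ofWord m := by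
  induction w with
  | var z => exact ⟨.of z, rfl⟩
  | br w _ => simp [degP] at h
  | varMul z w ih =>
    obtain ⟨m, rfl⟩ := ih h
    exact ⟨.of z * m, (ofWord_of_mul z m).symm⟩
  | brMul w' w _ _ => simp [degP] at h

theorem dbLT_ofWord [LinearOrder Z] {x y : FreeSemigroup Z} (h : DlexLT x y) :
    DbLT (ofWord x) (ofWord y) :=
  .of_blocks (by rw [degP_ofWord, degP_ofWord]) (by rw [brackets_ofWord, brackets_ofWord])
    [] [] [] _ _ (blocks_ofWord x) (blocks_ofWord y) h

theorem wordPlug_cons (z : Z) (a b : List Z) (w : FreeSemigroup Z) :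
    wordPlug (z :: a, b) w = FreeSemigroup.of z * wordPlug (a, b) w := by
  have h := wordPlug_toList (a, b) w
  ext1
  · rfl
  · rw [FreeSemigroup.tail_mul, h]
    rfl

theorem wordPlug_nil_nil (w : FreeSemigroup Z) : wordPlug ([], []) w = w := by
  simp [wordPlug]

theorem wordPlug_nil (w x : FreeSemigroup Z) : wordPlug ([], x.head :: x.tail) w = w * x := rfl

/-- The words with one `⋆` over `Z` that contain no bracket, as words with one `⋆`. -/
theorem exists_starWord (c : List Z × List Z) :
    ∃ q : StarWord Z, ∀ w, q.plug (ofWord w) = ofWord (wordPlug c w) := by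
  obtain ⟨a, b⟩ := c
  induction a with
  | nil =>
    cases b with
    | nil => exact ⟨.star, fun w => by rw [wordPlug_nil_nil]; rfl⟩
    | cons z b =>
      refine ⟨.starMul (ofWord ⟨z, b⟩), fun w => ?_⟩
      rw [StarWord.plug, ← map_mul]
      rfl
  | cons z a ih =>
    obtain ⟨q, hq⟩ := ih
    exact ⟨.varMulStar z q, fun w => by rw [StarWord.plug, hq, wordPlug_cons, ofWord_of_mul]⟩

/-- A context whose filled word has no bracket is itself bracket-free, hence a context of the free
semigroup. This brings inclusions into leading monomials of `G` back to the free algebra. -/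
theorem exists_of_degP_plug_eq_zero (q : StarWord Z) (b : OpWord Z) (h : degP (q.plug b) = 0) :
    degP b = 0 ∧ ∃ c : List Z × List Z, ∀ w, q.plug (ofWord w) = ofWord (wordPlug c w) := by
  induction q with
  | star => exact ⟨h, ([], []), fun w => by rw [wordPlug_nil_nil]; rfl⟩
  | starMul w =>
    rw [StarWord.plug, degP_mul] at h
    obtain ⟨x, rfl⟩ := exists_ofWord (w := w) (by omega)
    exact ⟨by omega, ([], x.head :: x.tail), fun w => by
      rw [wordPlug_nil, map_mul, StarWord.plug]⟩
  | br q _ => simp [StarWord.plug, degP] at h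
  | brMul q w _ => simp [StarWord.plug, degP] at h
  | varMulStar z q ih =>
    obtain ⟨hb, ⟨a, b⟩, hc⟩ := ih h
    exact ⟨hb, (z :: a, b), fun w => by rw [StarWord.plug, hc, wordPlug_cons, ofWord_of_mul]⟩
  | brMulStar w q _ => simp [StarWord.plug, degP] at h

/-- Separates the contexts that can produce a single bracketed letter from those that always produce
at least two letters. -/
theorem StarWord.cases_breadth (q : StarWord Z) :
    q = .star ∨ (∃ q', q = .br q') ∨ ∀ w, 2 ≤ breadth (q.plug w) := by
  cases q with
  | star => exact Or.inl rfl
  | starMul w => exact Or.inr (Or.inr fun x => two_le_breadth_mul x w)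
  | br q => exact Or.inr (Or.inl ⟨q, rfl⟩)
  | brMul q w => exact Or.inr (Or.inr fun x => two_le_breadth_mul (OpWord.br (q.plug x)) w)
  | varMulStar z q => exact Or.inr (Or.inr fun x => two_le_breadth_mul (var z) (q.plug x))
  | brMulStar w q => exact Or.inr (Or.inr fun x => two_le_breadth_mul (OpWord.br w) (q.plug x))

end OperatedGS

/-! ### Transport of leading monomials, the map `f ↦ ⌊f⌋ - λ f`, and the generated ideals. -/

namespace OperatedGS
open OpWord

variable {k : Type v} [Field k]

theorem IsLeading.mapDomain {S S' : Type u} {lt : S → S → Prop} {lt' : S' → S' → Prop}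
    {σ : S → S'} (hσ : Function.Injective σ) (hlt : ∀ x y, lt x y → lt' (σ x) (σ y))
    {f : S →₀ k} {m : S} (h : IsLeading lt f m) : IsLeading lt' (f.mapDomain σ) (σ m) := by
  refine ⟨?_, fun m' hm' hne => ?_⟩
  · simpa [Finsupp.mapDomain_apply hσ] using h.1
  · obtain ⟨x, rfl⟩ := Finsupp.mem_range_of_mapDomain_ne_zero (Finsupp.mem_support_iff.1 hm')
    rw [Finsupp.mem_support_iff, Finsupp.mapDomain_apply hσ] at hm'
    exact hlt _ _ (h.2 x (Finsupp.mem_support_iff.2 hm') fun e => hne (e ▸ rfl))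

theorem IsLeading.smul {S : Type u} {lt : S → S → Prop} {f : S →₀ k} {m : S}
    (h : IsLeading lt f m) {c : k} (hc : c ≠ 0) : IsLeading lt (c • f) m := by
  rw [IsLeading, Finsupp.support_smul_eq hc]
  exact h

/-- If two elements have the same leading monomial, with coefficient `1`, then it cancels in their
difference. -/
theorem IsLeading.lt_of_mem_support_sub {S : Type u} {lt : S → S → Prop} {f g : S →₀ k} {m : S}
    (hf : IsLeading lt f m) (hg : IsLeading lt g m) (hf1 : f m = 1) (hg1 : g m = 1) {x : S}
    (hx : x ∈ (f - g).support) : lt x m := by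
  have hne : x ≠ m := by
    rintro rfl
    simp [hf1, hg1] at hx
  by_cases h : f x = 0
  · refine hg.2 x ?_ hne
    simpa [h] using hx
  · exact hf.2 x (Finsupp.mem_support_iff.2 h) hne

namespace MonoOrder

variable {S C : Type u} {plug : C → S → S}

theorem plug_injective (O : MonoOrder plug) (q : C) : Function.Injective (plug q) := by
  have := O.isWellOrder
  intro x y h
  rcases trichotomous_of O.lt x y with hxy | hxy | hxy
  · exact absurd (h ▸ O.plug_lt_plug q x y hxy) (irrefl_of O.lt _)
  · exact hxy
  · exact absurd (h ▸ O.plug_lt_plug q y x hxy) (irrefl_of O.lt _)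

theorem isLeading_plug (O : MonoOrder plug) (q : C) {f : S →₀ k} {m : S} (h : IsLeading O.lt f m) :
    IsLeading O.lt (f.mapDomain (plug q)) (plug q m) :=
  h.mapDomain (O.plug_injective q) (O.plug_lt_plug q)

end MonoOrder

variable {Z : Type u}

/-! ### Linear maps between the free algebras -/

/-- The linear map `f ↦ ⌊f⌋ - λ f`. -/
noncomputable def relMap (lam : k) :
    MonoidAlgebra k (OpWord Z) →ₗ[k] MonoidAlgebra k (OpWord Z) :=
  MonoidAlgebra.mapDomainLinearMap k k br - lam • LinearMap.id

theorem relMap_apply (lam : k) (f : MonoidAlgebra k (OpWord Z)) :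
    relMap lam f = operator f - lam • f := rfl

/-- `ofFree` as a linear map. -/
noncomputable def ofFreeL : MonoidAlgebra k (FreeSemigroup Z) →ₗ[k] MonoidAlgebra k (OpWord Z) :=
  MonoidAlgebra.mapDomainLinearMap k k ofWord

theorem ofFreeL_apply (f : MonoidAlgebra k (FreeSemigroup Z)) : ofFreeL f = ofFree f := rfl

theorem ofFreeL_mul (f g : MonoidAlgebra k (FreeSemigroup Z)) :
    ofFreeL (f * g) = ofFreeL f * ofFreeL g :=
  MonoidAlgebra.mapDomain_mul ofWord f g

theorem ofFreeL_single (w : FreeSemigroup Z) (c : k) :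
    ofFreeL (MonoidAlgebra.single w c) = MonoidAlgebra.single (ofWord w) c :=
  MonoidAlgebra.mapDomainLinearMap_single _ _ _

theorem coeff_ofFree (f : MonoidAlgebra k (FreeSemigroup Z)) (w : FreeSemigroup Z) :
    (ofFree f).coeff (ofWord w) = f.coeff w :=
  Finsupp.mapDomain_apply ofWord_injective _ _

theorem degP_of_mem_support_ofFree {f : MonoidAlgebra k (FreeSemigroup Z)} {w : OpWord Z}
    (hw : w ∈ (ofFree f).coeff.support) : degP w = 0 := by
  obtain ⟨x, rfl⟩ := Finsupp.mem_range_of_mapDomain_ne_zero (Finsupp.mem_support_iff.1 hw)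
  exact degP_ofWord x

/-- `ofLinear` as a linear map. -/
noncomputable def ofLinearL : (Z →₀ k) →ₗ[k] MonoidAlgebra k (OpWord Z) :=
  (MonoidAlgebra.coeffLinearEquiv k).symm.toLinearMap ∘ₗ Finsupp.lmapDomain k k var

theorem ofLinearL_apply (f : Z →₀ k) : ofLinearL f = ofLinear f := rfl

theorem coeff_ofLinear (f : Z →₀ k) (z : Z) : (ofLinear f).coeff (var z) = f z :=
  Finsupp.mapDomain_apply var_injective _ _

theorem exists_var_of_mem_support_ofLinear {f : Z →₀ k} {w : OpWord Z}
    (hw : w ∈ (ofLinear f).coeff.support) : ∃ z, w = var z := by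
  obtain ⟨x, rfl⟩ := Finsupp.mem_range_of_mapDomain_ne_zero (Finsupp.mem_support_iff.1 hw)
  exact ⟨x, rfl⟩

/-- The linear part of an element of the free operated algebra. -/
noncomputable def varPart : MonoidAlgebra k (OpWord Z) →ₗ[k] (Z →₀ k) :=
  Finsupp.lcomapDomain var var_injective ∘ₗ (MonoidAlgebra.coeffLinearEquiv k).toLinearMap

theorem varPart_apply (f : MonoidAlgebra k (OpWord Z)) (z : Z) :
    varPart f z = f.coeff (var z) := rfl

theorem varPart_ofFree (f : MonoidAlgebra k (FreeSemigroup Z)) :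
    varPart (ofFree f) = linearPart f := by
  ext z
  rw [varPart_apply, ← ofWord_of, coeff_ofFree]
  rfl

theorem varPart_ofLinear (f : Z →₀ k) : varPart (ofLinear f) = f := by
  ext z
  rw [varPart_apply, coeff_ofLinear]

theorem varPart_eq_zero {f : MonoidAlgebra k (OpWord Z)}
    (h : ∀ w ∈ f.coeff.support, 2 ≤ breadth w) : varPart f = 0 := by
  ext z
  rw [varPart_apply, Finsupp.zero_apply]
  by_contra hne
  exact ((two_le_breadth_iff _).1 (h _ (Finsupp.mem_support_iff.2 hne))).1 z rfl

/-- If no bracketed word occurs in `f` as a monomial of breadth `1`, then `⌊f⌋ - λ f` is a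
combination of `⌊l⌋ - λ l`, with `l` the linear part of `f`, and of the `⌊w⌋ - λ w` with `w` a
monomial of `f` of breadth at least `2`. -/
theorem relMap_mem {lam : k} {f : MonoidAlgebra k (OpWord Z)}
    {W : Submodule k (MonoidAlgebra k (OpWord Z))}
    (hbr : ∀ w ∈ f.coeff.support, ∀ x, w ≠ br x)
    (hlin : relMap lam (ofLinear (varPart f)) ∈ W)
    (hW : ∀ w ∈ f.coeff.support, 2 ≤ breadth w → relMap lam (MonoidAlgebra.single w 1) ∈ W) :
    relMap lam f ∈ W := by
  -- Removing the linear part leaves no variable as a monomial, and `hbr` excludes single brackets,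
  -- so all monomials of `r` have breadth at least 2.
  set r := f - ofLinear (varPart f) with hr
  have hrf : f = ofLinear (varPart f) + r := by rw [hr]; abel
  have happ : ∀ w, r.coeff w = f.coeff w - (ofLinear (varPart f)).coeff w := fun w => rfl
  rw [hrf, map_add]
  refine W.add_mem hlin ?_
  rw [← MonoidAlgebra.sum_coeff_single r, Finsupp.sum, map_sum]
  refine W.sum_mem fun w hw => ?_
  rw [← mul_one (r.coeff w), ← smul_eq_mul, ← MonoidAlgebra.smul_single, map_smul]
  have hvar : ∀ z, w ≠ var z := by
    rintro z rfl
    rw [Finsupp.mem_support_iff, happ, coeff_ofLinear, varPart_apply, sub_self] at hw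
    exact hw rfl
  have hlw : (ofLinear (varPart f)).coeff w = 0 := by
    by_contra hne
    obtain ⟨z, hz⟩ := exists_var_of_mem_support_ofLinear (Finsupp.mem_support_iff.2 hne)
    exact hvar z hz
  rw [Finsupp.mem_support_iff, happ, hlw, sub_zero, ← Finsupp.mem_support_iff] at hw
  exact W.smul_mem _ (hW w hw ((two_le_breadth_iff w).2 ⟨hvar, hbr w hw⟩))

/-- The words that factor as a product `u v` are exactly those of breadth at least 2, so instances
are indexed by one word instead of two. -/
theorem mem_instances_phi4_iff {lam : k} {p : MonoidAlgebra k (OpWord Z)} :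
    p ∈ instances (phi4 lam) Z ↔
      ∃ w, 2 ≤ breadth w ∧ p = relMap lam (MonoidAlgebra.single w 1) := by
  have key : ∀ σ : Fin 2 → OpWord Z, MonoidAlgebra.mapDomain (subst σ) (phi4 lam) =
      relMap lam (MonoidAlgebra.single (σ 0 * σ 1) 1) := by
    intro σ
    have h : ∀ f, MonoidAlgebra.mapDomain (subst σ) f =
        MonoidAlgebra.mapDomainLinearMap k k (subst σ) f := fun _ => rfl
    rw [h, phi4, map_sub, MonoidAlgebra.mapDomainLinearMap_single,
      MonoidAlgebra.mapDomainLinearMap_single, relMap_apply, operator,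
      MonoidAlgebra.mapDomain_single, MonoidAlgebra.smul_single, smul_eq_mul, mul_one]
    rfl
  constructor
  · rintro ⟨σ, rfl⟩
    exact ⟨_, two_le_breadth_mul _ _, key σ⟩
  · rintro ⟨w, hw, rfl⟩
    obtain ⟨a, b, rfl⟩ := exists_eq_mul hw
    exact ⟨![a, b], (key ![a, b]).symm⟩

/-! ### Equality of the generated ideals -/

/-- Both sides are infima, so it suffices that the same operated ideals `J` contain the two
generating sets. -/
theorem operatedIdealSpan_eq {lam : k} {G : Set (MonoidAlgebra k (FreeSemigroup Z))}
    {B : Set (Z →₀ k)} (hB : Submodule.span k B = Submodule.span k (linearPart '' G)) :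
    operatedIdealSpan (instances (phi4 lam) Z ∪ ofFree '' G ∪ linearRelations lam B) =
      operatedIdealSpan (instances (phi4 lam) Z ∪
        ofFree '' (idealSpan G : Set (MonoidAlgebra k (FreeSemigroup Z)))) := by
  have hGI : G ⊆ idealSpan G := fun g hg =>
    (Submodule.mem_sInf).2 fun J hJ => hJ.2 hg
  unfold operatedIdealSpan
  congr 1
  ext J
  refine and_congr_right fun hJ => and_congr_right fun hop => ?_
  constructor
  · intro hT
    refine Set.union_subset (fun p hp => hT (Or.inl (Or.inl hp))) ?_
    -- The preimage of `J` in the free algebra is a two-sided ideal containing `G`.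
    have hle : idealSpan G ≤ J.comap ofFreeL := by
      refine sInf_le ⟨fun x hx a => ?_, fun g hg => hT (Or.inl (Or.inr ⟨g, hg, rfl⟩))⟩
      simp only [Submodule.mem_comap, ofFreeL_mul] at hx ⊢
      exact hJ _ hx _
    rintro _ ⟨g, hg, rfl⟩
    exact hle hg
  · intro hT
    refine Set.union_subset (Set.union_subset (fun p hp => hT (Or.inl hp)) ?_) ?_
    · rintro _ ⟨g, hg, rfl⟩
      exact hT (Or.inr ⟨g, hGI hg, rfl⟩)
    · rintro _ ⟨h, hh, rfl⟩
      -- Membership is linear in the element of `k Z`, and `B` spans `k π(G)`, so it can be checked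
      -- on `π(G)`.
      have hle : Submodule.span k B ≤ J.comap (relMap lam ∘ₗ ofLinearL) := by
        rw [hB, Submodule.span_le]
        rintro _ ⟨g, hg, rfl⟩
        have hgJ : ofFree g ∈ J := hT (Or.inr ⟨g, hGI hg, rfl⟩)
        have h1 : relMap lam (ofFree g) ∈ J := J.sub_mem (hop _ hgJ) (J.smul_mem _ hgJ)
        set r := ofFree g - ofLinear (linearPart g) with hr
        -- `r` has zero linear part and no bracket, so only instances of `phi4` are needed.
        have h2 : relMap lam r ∈ J := by
          refine relMap_mem (fun w hw x => ?_) ?_ fun w _ hw =>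
            hT (Or.inl (mem_instances_phi4_iff.2 ⟨w, hw, rfl⟩))
          · rintro rfl
            have hv : (ofLinear (linearPart g)).coeff (br x) = 0 := by
              by_contra hne
              obtain ⟨z, hz⟩ :=
                exists_var_of_mem_support_ofLinear (Finsupp.mem_support_iff.2 hne)
              cases hz
            have hf : (ofFree g).coeff (br x) = 0 := by
              by_contra hne
              have := degP_of_mem_support_ofFree (Finsupp.mem_support_iff.2 hne)
              simp [degP] at this
            rw [Finsupp.mem_support_iff, hr, MonoidAlgebra.coeff_sub, Finsupp.sub_apply, hv, hf,
              sub_self] at hw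
            exact hw rfl
          · rw [hr, map_sub, varPart_ofFree, varPart_ofLinear, sub_self, ← ofLinearL_apply,
              map_zero, map_zero]
            exact J.zero_mem
        have h3 : relMap lam (ofLinear (linearPart g)) ∈ J := by
          have := J.sub_mem h1 h2
          rwa [← map_sub, hr, sub_sub_cancel] at this
        exact h3
      exact hle (Submodule.subset_span hh)

end OperatedGS

/-! ### Triviality of the compositions. -/

namespace OperatedGS
open OpWord

variable {k : Type v} [Field k] {Z : Type u}

theorem mapDomain_plug_star (f : MonoidAlgebra k (OpWord Z)) :
    MonoidAlgebra.mapDomain (StarWord.plug .star) f = f := by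
  ext1
  exact Finsupp.mapDomain_id

theorem mapDomain_plug_br (q : StarWord Z) (f : MonoidAlgebra k (OpWord Z)) :
    MonoidAlgebra.mapDomain (StarWord.plug (.br q)) f =
      operator (MonoidAlgebra.mapDomain q.plug f) := by
  ext1
  exact Finsupp.mapDomain_comp

/-- The set `S_φ₄(𝔖(Z)) ∪ G ∪ {⌊h⌋ - λ h : h ∈ B}`. -/
def homGenerators (lam : k) (G : Set (MonoidAlgebra k (FreeSemigroup Z))) (B : Set (Z →₀ k)) :
    Set (MonoidAlgebra k (OpWord Z)) :=
  instances (phi4 lam) Z ∪ ofFree '' G ∪ linearRelations lam B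

theorem relMap_single_mem {lam : k} {G : Set (MonoidAlgebra k (FreeSemigroup Z))} {B : Set (Z →₀ k)}
    {w : OpWord Z} (hw : 2 ≤ breadth w) :
    relMap lam (MonoidAlgebra.single w 1) ∈ homGenerators lam G B :=
  Or.inl (Or.inl (mem_instances_phi4_iff.2 ⟨w, hw, rfl⟩))

theorem relMap_ofLinear_mem {lam : k} {G : Set (MonoidAlgebra k (FreeSemigroup Z))} {B : Set (Z →₀ k)}
    {h : Z →₀ k} (hh : h ∈ B) :
    relMap lam (ofLinear h) ∈ homGenerators lam G B :=
  Or.inr ⟨h, hh, rfl⟩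

theorem isLeading_single [LinearOrder Z] (w : OpWord Z) :
    IsLeading DbLT (MonoidAlgebra.single w (1 : k)).coeff w :=
  ⟨by simp, fun _ hm' hne =>
    absurd (Finset.mem_singleton.1 (Finsupp.support_single_subset hm')) hne⟩

theorem isLeading_ofLinear [LinearOrder Z] {h : Z →₀ k} {i : Z} (hi : IsLeading (· < ·) h i) :
    IsLeading DbLT (ofLinear h).coeff (var i) :=
  hi.mapDomain var_injective fun _ _ => dbLT_var

theorem isLeading_ofFree [LinearOrder Z] {g : MonoidAlgebra k (FreeSemigroup Z)} {m : FreeSemigroup Z}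
    (h : IsLeading DlexLT g.coeff m) : IsLeading DbLT (ofFree g).coeff (ofWord m) :=
  h.mapDomain ofWord_injective fun _ _ => dbLT_ofWord

variable [LinearOrder Z] [WellFoundedLT Z]

theorem IsLeading.unique_dbLT {f : OpWord Z →₀ k} {a b : OpWord Z} (ha : IsLeading DbLT f a)
    (hb : IsLeading DbLT f b) : a = b := by
  have : Std.Asymm (DbLT (Z := Z)) := ⟨fun _ _ => asymm_of DbLT⟩
  exact ha.unique hb

/-- The leading monomial of `⌊f⌋ - λ f` is `⌊m⌋`, for `m` the leading monomial of `f`. -/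
theorem isLeading_relMap {lam : k} {f : MonoidAlgebra k (OpWord Z)} {m : OpWord Z}
    (h : IsLeading DbLT f.coeff m) :
    IsLeading DbLT (relMap lam f).coeff (br m) ∧ (relMap lam f).coeff (br m) = f.coeff m := by
  have happ : ∀ w, (relMap lam f).coeff w =
      (f.coeff.mapDomain br) w - lam * f.coeff w := fun w => rfl
  -- All of `f` lies strictly below `⌊m⌋`, so the summand `-λ f` cannot affect the leading term.
  have hlt : ∀ w ∈ f.coeff.support, DbLT w (br m) := by
    intro w hw
    by_cases hwm : w = m
    · exact hwm ▸ dbLT_br_self m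
    · exact trans_of DbLT (h.2 w hw hwm) (dbLT_br_self m)
  have hbm : f.coeff (br m) = 0 := by
    by_contra hne
    exact irrefl_of DbLT _ (hlt _ (Finsupp.mem_support_iff.2 hne))
  have hc : (relMap lam f).coeff (br m) = f.coeff m := by
    rw [happ, hbm, mul_zero, sub_zero, Finsupp.mapDomain_apply br_injective]
  refine ⟨⟨?_, fun w hw hne => ?_⟩, hc⟩
  · rw [Finsupp.mem_support_iff, hc]
    exact h.apply_ne_zero
  · by_cases hwf : f.coeff w = 0
    · rw [Finsupp.mem_support_iff, happ, hwf, mul_zero, sub_zero] at hw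
      obtain ⟨x, rfl⟩ := Finsupp.mem_range_of_mapDomain_ne_zero hw
      rw [Finsupp.mapDomain_apply br_injective] at hw
      exact dbLT_br (h.2 x (Finsupp.mem_support_iff.2 hw) fun e => hne (e ▸ rfl))
    · exact hlt w (Finsupp.mem_support_iff.2 hwf)

/-- Converse of `isLeading_ofFree`: the embedding preserves strict inequalities between elements of
a total order, so it also reflects them. -/
theorem exists_isLeading_dlex {g : MonoidAlgebra k (FreeSemigroup Z)} {a : OpWord Z}
    (h : IsLeading DbLT (ofFree g).coeff a) :
    ∃ m, a = ofWord m ∧ IsLeading DlexLT g.coeff m := by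
  obtain ⟨m, rfl⟩ := exists_ofWord (degP_of_mem_support_ofFree h.1)
  have hsupp : ∀ x, x ∈ g.coeff.support ↔ ofWord x ∈ (ofFree g).coeff.support := fun x => by
    rw [Finsupp.mem_support_iff, Finsupp.mem_support_iff, coeff_ofFree]
  refine ⟨m, rfl, (hsupp m).2 h.1, fun x hx hne => ?_⟩
  have hlt := h.2 _ ((hsupp x).1 hx) fun e => hne (ofWord_injective e)
  have := (dlexOrder Z).isWellOrder
  rcases trichotomous_of (dlexOrder Z).lt x m with hxm | hxm | hxm
  · exact hxm
  · exact absurd hxm hne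
  · exact absurd (dbLT_ofWord hxm) (asymm_of DbLT hlt)

theorem isTrivialMod_plug {T : Set (MonoidAlgebra k (OpWord Z))} {s : MonoidAlgebra k (OpWord Z)}
    (hs : s ∈ T) {m w : OpWord Z} (hm : IsLeading DbLT s.coeff m) (q : StarWord Z)
    (hlt : DbLT (q.plug m) w) :
    IsTrivialMod (dbOrder Z) T w (MonoidAlgebra.mapDomain q.plug s) :=
  Submodule.subset_span ⟨s, hs, q, m, hm, hlt, rfl⟩

theorem isTrivialMod_self {T : Set (MonoidAlgebra k (OpWord Z))} {s : MonoidAlgebra k (OpWord Z)}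
    (hs : s ∈ T) {m w : OpWord Z} (hm : IsLeading DbLT s.coeff m) (hlt : DbLT m w) :
    IsTrivialMod (dbOrder Z) T w s := by
  have := isTrivialMod_plug hs hm .star hlt
  rwa [mapDomain_plug_star] at this

/-- Triviality in the free algebra implies triviality in the free operated algebra. -/
theorem isTrivialMod_ofFree {G : Set (MonoidAlgebra k (FreeSemigroup Z))}
    {T : Set (MonoidAlgebra k (OpWord Z))} (hGT : ofFree '' G ⊆ T) {w : FreeSemigroup Z}
    {f : MonoidAlgebra k (FreeSemigroup Z)} (h : IsTrivialMod (dlexOrder Z) G w f) :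
    IsTrivialMod (dbOrder Z) T (ofWord w) (ofFree f) := by
  -- Trivial elements form a subspace, so only a single `q|_s` with `s ∈ G` has to be carried over.
  refine (Submodule.span_le (p := Submodule.comap ofFreeL (Submodule.span k _))).2 ?_ h
  rintro _ ⟨s, hs, c, m, hm, hlt, rfl⟩
  obtain ⟨q, hq⟩ := exists_starWord c
  refine Submodule.subset_span ⟨ofFree s, hGT ⟨s, hs, rfl⟩, q, ofWord m, isLeading_ofFree hm, ?_, ?_⟩
  · change DbLT (q.plug (ofWord m)) (ofWord w)
    rw [hq]
    exact dbLT_ofWord hlt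
  · ext1
    change Finsupp.mapDomain ofWord (Finsupp.mapDomain (wordPlug c) s.coeff) =
      Finsupp.mapDomain q.plug (Finsupp.mapDomain ofWord s.coeff)
    rw [← Finsupp.mapDomain_comp, ← Finsupp.mapDomain_comp]
    congr 1
    funext x
    exact (hq x).symm

section

variable {lam : k} {G : Set (MonoidAlgebra k (FreeSemigroup Z))} {B : Set (Z →₀ k)}

/-- The reduction step for inclusions inside a bracket. Each relation used has leading monomial
`⌊w⌋` with `w` a monomial of `f`, and `w < m` gives `⌊w⌋ < ⌊m⌋`. -/
theorem isTrivialMod_relMap (hB : IsLinearlySelfReduced B) {f : MonoidAlgebra k (OpWord Z)}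
    {m : OpWord Z} (hlt : ∀ w ∈ f.coeff.support, DbLT w m)
    (hbr : ∀ w ∈ f.coeff.support, ∀ x, w ≠ br x) (hlin : varPart f ∈ Submodule.span k B) :
    IsTrivialMod (dbOrder Z) (homGenerators lam G B) (br m) (relMap lam f) := by
  refine relMap_mem hbr ?_ fun w hw h2 => ?_
  -- An arbitrary expansion over a spanning set could use leading variables that cancel and are too
  -- large. Self-reducedness allows only `h` whose leading variable occurs in `f`.
  · refine (Submodule.span_le
      (p := Submodule.comap (relMap lam ∘ₗ ofLinearL) (Submodule.span k _))).2 ?_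
      (hB.mem_span_leading hlin)
    rintro h ⟨hh, i, hi, hfi⟩
    have hlead := isLeading_relMap (lam := lam) (isLeading_ofLinear hi)
    exact isTrivialMod_self (relMap_ofLinear_mem hh) hlead.1
      (dbLT_br (hlt _ (Finsupp.mem_support_iff.2 hfi)))
  · exact isTrivialMod_self (relMap_single_mem h2) (isLeading_relMap (isLeading_single w)).1
      (dbLT_br (hlt w hw))

/-- The inclusion composition of `⌊f⌋ - λ f` with an element occurring inside the bracket. -/
theorem isTrivialMod_inclusion_br {T : Set (MonoidAlgebra k (OpWord Z))}
    {f g : MonoidAlgebra k (OpWord Z)} {m b : OpWord Z} {q : StarWord Z} (hg : g ∈ T)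
    (hb : IsLeading DbLT g.coeff b) (hqb : q.plug b = m)
    (h : IsTrivialMod (dbOrder Z) T (br m)
      (relMap lam (f - MonoidAlgebra.mapDomain q.plug ((g.coeff b)⁻¹ • g)))) :
    IsTrivialMod (dbOrder Z) T (br m)
      (relMap lam f -
        MonoidAlgebra.mapDomain (StarWord.plug (.br q)) ((g.coeff b)⁻¹ • g)) := by
  set r := MonoidAlgebra.mapDomain q.plug ((g.coeff b)⁻¹ • g) with hr
  have hrt : IsTrivialMod (dbOrder Z) T (br m) r := by
    have := isTrivialMod_plug hg hb q (w := br m) (hqb ▸ dbLT_br_self m)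
    have h2 := Submodule.smul_mem _ (g.coeff b)⁻¹ this
    have h3 : r = (g.coeff b)⁻¹ • MonoidAlgebra.mapDomain q.plug g :=
      map_smul (MonoidAlgebra.mapDomainLinearMap k k q.plug) _ _
    rw [h3]
    exact h2
  -- Since `⌊r⌋ = relMap lam r + λ r`, replacing `⌊r⌋` leaves a multiple of `r`, which is trivial
  -- because `q|_b = m < ⌊m⌋`.
  have e : relMap lam f - MonoidAlgebra.mapDomain (StarWord.plug (.br q)) ((g.coeff b)⁻¹ • g) =
      relMap lam (f - r) - lam • r := by
    rw [mapDomain_plug_br, ← hr, map_sub, relMap_apply lam r]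
    abel
  rw [e]
  exact Submodule.sub_mem _ h (Submodule.smul_mem _ _ hrt)

/-- The possible leading monomials. The generators outside `G` are already monic. -/
theorem mem_homGenerators_cases (hB : IsLinearlySelfReduced B) {g : MonoidAlgebra k (OpWord Z)}
    (hg : g ∈ homGenerators lam G B) {b : OpWord Z} (hb : IsLeading DbLT g.coeff b) :
    (∃ g₀ ∈ G, ∃ n, g = ofFree g₀ ∧ b = ofWord n ∧ IsLeading DlexLT g₀.coeff n) ∨
    (∃ w, 2 ≤ breadth w ∧ g = relMap lam (MonoidAlgebra.single w 1) ∧ b = br w ∧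
      g.coeff b = 1) ∨
    (∃ h ∈ B, ∃ i, IsLeading (· < ·) h i ∧ h i = 1 ∧ g = relMap lam (ofLinear h) ∧
      b = br (var i) ∧ g.coeff b = 1) := by
  rcases hg with (hg | ⟨g₀, hg₀, rfl⟩) | ⟨h, hh, rfl⟩
  · obtain ⟨w, hw, rfl⟩ := mem_instances_phi4_iff.1 hg
    have hl := isLeading_relMap (lam := lam) (isLeading_single (k := k) w)
    obtain rfl := hb.unique_dbLT hl.1
    exact Or.inr (Or.inl ⟨w, hw, rfl, rfl, hl.2.trans (by simp)⟩)
  · obtain ⟨n, hn, hl⟩ := exists_isLeading_dlex hb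
    exact Or.inl ⟨g₀, hg₀, n, rfl, hn, hl⟩
  · obtain ⟨i, hi, h1⟩ := (hB h hh).1
    have hl := isLeading_relMap (lam := lam) (isLeading_ofLinear hi)
    obtain rfl := hb.unique_dbLT hl.1
    exact Or.inr (Or.inr ⟨h, hh, i, hi, h1, rfl, rfl, hl.2.trans ((coeff_ofLinear h i).trans h1)⟩)

theorem ofFree_or_br_of_mem_homGenerators (hB : IsLinearlySelfReduced B)
    {g : MonoidAlgebra k (OpWord Z)} (hg : g ∈ homGenerators lam G B) {b : OpWord Z}
    (hb : IsLeading DbLT g.coeff b) :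
    (∃ g₀ ∈ G, ∃ n, g = ofFree g₀ ∧ b = ofWord n ∧ IsLeading DlexLT g₀.coeff n) ∨
      ∃ x, b = br x := by
  rcases mem_homGenerators_cases hB hg hb with h | ⟨w, -, -, h, -⟩ | ⟨_, -, i, -, -, -, h, -⟩
  · exact Or.inl h
  · exact Or.inr ⟨w, h⟩
  · exact Or.inr ⟨_, h⟩

/-- The support of `f - q|_g`, where `f` and `q|_g` have the same leading monomial. -/
theorem dbLT_of_mem_support_sub {f g : MonoidAlgebra k (OpWord Z)} {m b : OpWord Z}
    {q : StarWord Z} (hf : IsLeading DbLT f.coeff m) (hf1 : f.coeff m = 1)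
    (hb : IsLeading DbLT g.coeff b) (hqb : q.plug b = m) {w : OpWord Z}
    (hw : w ∈ (f - MonoidAlgebra.mapDomain q.plug ((g.coeff b)⁻¹ • g)).coeff.support) :
    DbLT w m := by
  have hb0 := hb.apply_ne_zero
  have h := (dbOrder Z).isLeading_plug q (hb.smul (inv_ne_zero hb0))
  refine hf.lt_of_mem_support_sub (hqb ▸ h) hf1 ?_ hw
  change (Finsupp.mapDomain q.plug ((g.coeff b)⁻¹ • g.coeff)) m = 1
  rw [← hqb, Finsupp.mapDomain_apply ((dbOrder Z).plug_injective q), Finsupp.smul_apply,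
    smul_eq_mul, inv_mul_cancel₀ hb0]

/-- The inclusion composition of `⌊f⌋ - λ f` and an element of `G`, where the leading monomials of
`f` and of the element of `G` are equal. -/
theorem isTrivialMod_relMap_sub_ofFree (hB : IsLinearlySelfReduced B)
    (hBG : Submodule.span k B = Submodule.span k (linearPart '' G))
    {f : MonoidAlgebra k (OpWord Z)} {g₀ : MonoidAlgebra k (FreeSemigroup Z)} (hg₀ : g₀ ∈ G)
    {m : OpWord Z} (hf : IsLeading DbLT f.coeff m) (hf1 : f.coeff m = 1)
    (hb : IsLeading DbLT (ofFree g₀).coeff m) (hfv : varPart f ∈ Submodule.span k B)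
    (hfP : ∀ w ∈ f.coeff.support, degP w = 0) :
    IsTrivialMod (dbOrder Z) (homGenerators lam G B) (br m)
      (relMap lam (f - MonoidAlgebra.mapDomain (StarWord.plug .star)
        (((ofFree g₀).coeff m)⁻¹ • ofFree g₀))) := by
  refine isTrivialMod_relMap hB (fun w hw => dbLT_of_mem_support_sub hf hf1 hb rfl hw) ?_ ?_
  · rintro w hw x rfl
    rw [mapDomain_plug_star, Finsupp.mem_support_iff] at hw
    have h1 : f.coeff (br x) = 0 := by
      by_contra hne
      have := hfP _ (Finsupp.mem_support_iff.2 hne)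
      simp [degP] at this
    have h2 : (ofFree g₀).coeff (br x) = 0 := by
      by_contra hne
      have := degP_of_mem_support_ofFree (Finsupp.mem_support_iff.2 hne)
      simp [degP] at this
    simp [h1, h2] at hw
  -- The difference may have a nonzero linear part, a multiple of `π g₀` added to that of `f`; this
  -- is why the relations from `B` are required.
  · rw [mapDomain_plug_star, map_sub, map_smul, varPart_ofFree]
    refine Submodule.sub_mem _ hfv (Submodule.smul_mem _ _ ?_)
    rw [hBG]
    exact Submodule.subset_span ⟨g₀, hg₀, rfl⟩

theorem isTrivialMod_zero {T : Set (MonoidAlgebra k (OpWord Z))} {w : OpWord Z}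
    {f : MonoidAlgebra k (OpWord Z)} (h : f = 0) : IsTrivialMod (dbOrder Z) T w f := by
  rw [h]
  exact Submodule.zero_mem _

/-- Case analysis on the kind of `f` and then on the shape of the context. If `f` is not from `G`,
then `a` is one bracket, so the inclusion is either at the top or inside that bracket. -/
theorem isTrivialMod_inclusion (hG : IsGSBasis (dlexOrder Z) FreeSemigroup.length G)
    (hB : IsLinearlySelfReduced B)
    (hBG : Submodule.span k B = Submodule.span k (linearPart '' G))
    {f g : MonoidAlgebra k (OpWord Z)} (hf : f ∈ homGenerators lam G B)
    (hg : g ∈ homGenerators lam G B) {a b : OpWord Z} (ha : IsLeading DbLT f.coeff a)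
    (hb : IsLeading DbLT g.coeff b) (q : StarWord Z) (hq : a = q.plug b) :
    IsTrivialMod (dbOrder Z) (homGenerators lam G B) a
      ((f.coeff a)⁻¹ • f - MonoidAlgebra.mapDomain q.plug ((g.coeff b)⁻¹ • g)) := by
  rcases mem_homGenerators_cases hB hf ha with ⟨f₀, hf₀, m, rfl, rfl, hm⟩ |
    ⟨w, hw, rfl, rfl, h1⟩ | ⟨h, hh, i, hi, hi1, rfl, rfl, h1⟩
  -- Here `a` is bracket-free, which forces `g` to come from `G` as well.
  · obtain ⟨hb0, c, hc⟩ := exists_of_degP_plug_eq_zero q b (hq ▸ degP_ofWord m)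
    rcases ofFree_or_br_of_mem_homGenerators hB hg hb with ⟨g₀, hg₀, n, rfl, rfl, hn⟩ | ⟨x, rfl⟩
    · have hmn : m = wordPlug c n := ofWord_injective (hq.trans (hc n))
      have h := isTrivialMod_ofFree (T := homGenerators lam G B)
        (fun p hp => Or.inl (Or.inr hp)) ((hG f₀ hf₀ g₀ hg₀ m n hm hn).2 c hmn)
      rw [coeff_ofFree, coeff_ofFree]
      convert h using 1
      rw [← ofFreeL_apply (_ - _), map_sub, map_smul]
      congr 1
      ext1
      change Finsupp.mapDomain q.plug (_ • Finsupp.mapDomain ofWord g₀.coeff) =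
        Finsupp.mapDomain ofWord (Finsupp.mapDomain (wordPlug c) (_ • g₀.coeff))
      rw [← Finsupp.mapDomain_smul, ← Finsupp.mapDomain_comp, ← Finsupp.mapDomain_comp]
      congr 1
      funext x
      exact hc x
    · simp [degP] at hb0
  · rw [h1, inv_one, one_smul]
    rcases q.cases_breadth with rfl | ⟨q, rfl⟩ | h2
    -- Equal leading monomials `⌊w⌋` with `2 ≤ breadth w` determine the instance of `phi4`, so `g =
    -- f`.
    · apply isTrivialMod_zero
      have hb' : br w = b := hq
      rcases mem_homGenerators_cases hB hg hb with ⟨g₀, hg₀, n, rfl, rfl, hn⟩ |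
        ⟨w', hw', rfl, rfl, h1'⟩ | ⟨h', hh', i', hi', hi1', rfl, rfl, h1'⟩
      · have := congrArg degP hb'
        rw [degP_ofWord] at this
        simp [degP] at this
      · obtain rfl := br_injective hb'
        rw [h1', inv_one, one_smul, mapDomain_plug_star, sub_self]
      · rw [br_injective hb'] at hw
        simp [breadth] at hw
    · have hq' : q.plug b = w := (br_injective hq).symm
      refine isTrivialMod_inclusion_br hg hb hq' ?_
      have hw1 : (MonoidAlgebra.single w (1 : k)).coeff w = 1 := by simp
      have hws : ∀ x ∈ (MonoidAlgebra.single w (1 : k)).coeff.support, x = w := fun x hx =>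
        Finset.mem_singleton.1 (Finsupp.support_single_subset hx)
      have hwv : varPart (MonoidAlgebra.single w (1 : k)) = 0 :=
        varPart_eq_zero fun x hx => hws x hx ▸ hw
      -- If the context `q` always yields breadth at least 2, so do all monomials of the difference,
      -- and its linear part vanishes.
      have general : (∀ x, 2 ≤ breadth (q.plug x)) →
          IsTrivialMod (dbOrder Z) (homGenerators lam G B) (br w)
            (relMap lam (MonoidAlgebra.single w 1 -
              MonoidAlgebra.mapDomain q.plug ((g.coeff b)⁻¹ • g))) := by
        intro h2
        have hs : ∀ x ∈ (MonoidAlgebra.single w 1 -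
            MonoidAlgebra.mapDomain q.plug ((g.coeff b)⁻¹ • g)).coeff.support,
            2 ≤ breadth x := by
          intro x hx
          by_cases hxw : x = w
          · exact hxw ▸ hw
          · have h0 : (MonoidAlgebra.single w (1 : k)).coeff x = 0 := by
              by_contra hne
              exact hxw (hws x (Finsupp.mem_support_iff.2 hne))
            rw [Finsupp.mem_support_iff, MonoidAlgebra.coeff_sub, Finsupp.sub_apply, h0,
              zero_sub, neg_ne_zero] at hx
            obtain ⟨y, rfl⟩ := Finsupp.mem_range_of_mapDomain_ne_zero hx
            exact h2 y
        refine isTrivialMod_relMap hB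
          (fun x hx => dbLT_of_mem_support_sub (isLeading_single w) hw1 hb hq' hx)
          (fun x hx => ((two_le_breadth_iff x).1 (hs x hx)).2) ?_
        rw [varPart_eq_zero hs]
        exact Submodule.zero_mem _
      rcases q.cases_breadth with rfl | ⟨q, rfl⟩ | h2
      -- The element `g` rewrites the whole content of the bracket. As `w` has at least two letters,
      -- `g` comes from `G`.
      · obtain rfl : b = w := hq'
        rcases ofFree_or_br_of_mem_homGenerators hB hg hb with
          ⟨g₀, hg₀, n, rfl, rfl, hn⟩ | ⟨x, rfl⟩
        · refine isTrivialMod_relMap_sub_ofFree hB hBG hg₀ (isLeading_single _) hw1 hb ?_ ?_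
          · rw [hwv]
            exact Submodule.zero_mem _
          · intro x hx
            rw [hws x hx, degP_ofWord]
        · simp [breadth] at hw
      · rw [← hq'] at hw
        simp [StarWord.plug, breadth] at hw
      · exact general h2
    · have := h2 b
      rw [← hq] at this
      simp [breadth] at this
  · rw [h1, inv_one, one_smul]
    rcases q.cases_breadth with rfl | ⟨q, rfl⟩ | h2
    · apply isTrivialMod_zero
      have hb' : br (var i) = b := hq
      rcases mem_homGenerators_cases hB hg hb with ⟨g₀, hg₀, n, rfl, rfl, hn⟩ |
        ⟨w', hw', rfl, rfl, h1'⟩ | ⟨h', hh', i', hi', hi1', rfl, rfl, h1'⟩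
      · have := congrArg degP hb'
        rw [degP_ofWord] at this
        simp [degP] at this
      · rw [← br_injective hb'] at hw'
        simp [breadth] at hw'
      · obtain rfl := var_injective (br_injective hb')
        -- In a self-reduced set, distinct elements cannot share a leading variable.
        have hhh : h = h' := by
          by_contra hne
          have := hB.apply_eq_zero hh' hh hne hi'
          rw [hi1] at this
          exact one_ne_zero this
        subst hhh
        rw [h1', inv_one, one_smul, mapDomain_plug_star, sub_self]
    · have hq' : q.plug b = var i := (br_injective hq).symm
      refine isTrivialMod_inclusion_br hg hb hq' ?_
      rcases q.cases_breadth with rfl | ⟨q, rfl⟩ | h2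
      -- The leading monomial of the element of `G` is the variable `i`; the linear part of the
      -- difference stays in `k π(G)`.
      · obtain rfl : b = var i := hq'
        rcases ofFree_or_br_of_mem_homGenerators hB hg hb with
          ⟨g₀, hg₀, n, rfl, -, -⟩ | ⟨x, hx⟩
        · refine isTrivialMod_relMap_sub_ofFree hB hBG hg₀ (isLeading_ofLinear hi)
            ((coeff_ofLinear h i).trans hi1) hb ?_ ?_
          · rw [varPart_ofLinear]
            exact Submodule.subset_span hh
          · intro x hx
            obtain ⟨z, rfl⟩ := exists_var_of_mem_support_ofLinear hx
            rfl
        · cases hx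
      · cases hq'
      · have := h2 b
        rw [hq'] at this
        simp [breadth] at this
    · have := h2 b
      rw [← hq] at this
      simp [breadth] at this

/-- If `a` or `b` had breadth 1, the breadth of `w` would lie strictly between two consecutive
integers. So both elements come from `G`. -/
theorem isTrivialMod_intersection (hG : IsGSBasis (dlexOrder Z) FreeSemigroup.length G)
    (hB : IsLinearlySelfReduced B)
    {f g : MonoidAlgebra k (OpWord Z)} (hf : f ∈ homGenerators lam G B)
    (hg : g ∈ homGenerators lam G B) {a b : OpWord Z} (ha : IsLeading DbLT f.coeff a)
    (hb : IsLeading DbLT g.coeff b) {w u v : OpWord Z} (hu : w = a * u) (hv : w = v * b)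
    (hmax : max (breadth a) (breadth b) < breadth w)
    (hlt : breadth w < breadth a + breadth b) :
    IsTrivialMod (dbOrder Z) (homGenerators lam G B) w
      ((f.coeff a)⁻¹ • f * MonoidAlgebra.single u 1 -
        MonoidAlgebra.single v 1 * (g.coeff b)⁻¹ • g) := by
  rcases ofFree_or_br_of_mem_homGenerators hB hf ha with ⟨f₀, hf₀, m, rfl, rfl, hm⟩ | ⟨x, rfl⟩
  swap
  · have : breadth (br x) = 1 := rfl
    omega
  rcases ofFree_or_br_of_mem_homGenerators hB hg hb with ⟨g₀, hg₀, n, rfl, rfl, hn⟩ | ⟨x, rfl⟩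
  swap
  · have : breadth (br x) = 1 := rfl
    omega
  -- The cofactors `u` and `v` are bracket-free too, so the whole overlap takes place in the free
  -- semigroup.
  have huP : degP u = 0 :=
    degP_eq_zero_of_overlap (hu.symm.trans hv) (hu ▸ hlt) (degP_ofWord n)
  have hvP : degP v = 0 := by
    have := congrArg degP (hu.symm.trans hv)
    rw [degP_mul, degP_mul, huP, degP_ofWord, degP_ofWord] at this
    omega
  obtain ⟨u, rfl⟩ := exists_ofWord huP
  obtain ⟨v, rfl⟩ := exists_ofWord hvP
  rw [← map_mul] at hu hv
  subst hu
  have h := (hG f₀ hf₀ g₀ hg₀ m n hm hn).1 (m * u) u v rfl (ofWord_injective hv)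
    (by simpa only [breadth_ofWord] using hmax) (by simpa only [breadth_ofWord] using hlt)
  have h' := isTrivialMod_ofFree (T := homGenerators lam G B)
    (fun p hp => Or.inl (Or.inr hp)) h
  rw [coeff_ofFree, coeff_ofFree]
  convert h' using 1
  rw [← ofFreeL_apply (_ - _), map_sub, ofFreeL_mul, ofFreeL_mul, map_smul, map_smul,
    ofFreeL_single, ofFreeL_single]
  rfl

end

end OperatedGS

theorem mainTheorem3 {k : Type*} [Field k] {Z : Type*} [LinearOrder Z] [WellFoundedLT Z]
    (I : Submodule k (MonoidAlgebra k (FreeSemigroup Z)))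
    (G : Set (MonoidAlgebra k (FreeSemigroup Z))) (hfin : G.Finite)
    (hG : OperatedGS.IsGSBasisOf G I) (lam : k) :
    (∃! B : Set (Z →₀ k), OperatedGS.IsSelfReducedBasis B
      (Submodule.span k (OperatedGS.linearPart '' G))) ∧
    ∀ B : Set (Z →₀ k), OperatedGS.IsSelfReducedBasis B
        (Submodule.span k (OperatedGS.linearPart '' G)) →
      OperatedGS.IsOperatedGSBasisOf
        (OperatedGS.instances (OperatedGS.phi4 lam) Z ∪ OperatedGS.ofFree '' G ∪
          OperatedGS.linearRelations lam B)
        (OperatedGS.operatedIdealSpan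
          (OperatedGS.instances (OperatedGS.phi4 lam) Z ∪
            OperatedGS.ofFree '' (I : Set (MonoidAlgebra k (FreeSemigroup Z))))) := by
  obtain ⟨hG, rfl⟩ := hG
  refine ⟨OperatedGS.existsUnique_isSelfReducedBasis _, fun B hB => ⟨?_, ?_⟩⟩
  · intro f hf g hg a b ha hb
    exact ⟨fun w u v hu hv hmax hlt =>
        OperatedGS.isTrivialMod_intersection hG hB.1 hf hg ha hb hu hv hmax hlt,
      fun q hq => OperatedGS.isTrivialMod_inclusion hG hB.1 hB.2.2 hf hg ha hb q hq⟩
  · exact OperatedGS.operatedIdealSpan_eq hB.2.2
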